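/- Let $P$ be an $n$-dimensional simple convex polytope with set of facets $\mathcal F(P)$, and for $N\ge 0$ let $T^N=(S^1)^N$. For $k\ge 0$, a hyper characteristic function is a map $\xi\colon\mathcal F(P)\to\mathbb Z^{n+k}$ such that $\xi(F_{1}),\dots,\xi(F_{n})$ are part of a $\mathbb Z$-basis of $\mathbb Z^{n+k}$ whenever $F_1,\dots,F_n$ are $n$ distinct facets with $F_1\cap\dots\cap F_n\ne\emptyset$; $\operatorname{rk}(\xi)$ denotes the rank of the subgroup of $\mathbb Z^{n+k}$ generated by the values of $\xi$. Put $$M(P,\xi)=(T^{n+k}\times P)/\sim,\qquad (t,p)\sim(s,q)\iff p=q\ \text{and}\ t^{-1}s\in T_p,$$ with the quotient topology and the action of $T^{n+k}$ by multiplication on the first factor. Here $T_p\subseteq T^{n+k}$ is the subgroup generated by the circles $\{(z^{a_1},\dots,z^{a_{n+k}}) : z\in S^1\}$ with $a=\xi(F)$, for the facets $F$ containing $p$. A locally $k$-standard $T$-manifold of dimension $2n+k$ is a smooth $(2n+k)$-dimensional manifold with an effective action of $T^{n+k}$ in which every point $x$ has an open invariant neighbourhood that is $\theta_x$-equivariantly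 diffeomorphic, for some automorphism $\theta_x$ of $T^{n+k}$, to an invariant open subset of $\mathbb C^n\times T^k\subset\mathbb C^{n+k}$ with the standard coordinatewise action of $T^{n+k}$. Proposition. Let $P$ be an $n$-dimensional simple polytope, let $\xi\colon\mathcal F(P)\to\mathbb Z^{n+k}$ be a hyper characteristic function, and let $0\le r<k$. Then $\operatorname{rk}(\xi)=n+r$ if and only if there is a hyper characteristic function $\tilde\xi\colon\mathcal F(P)\to\mathbb Z^{n+r}$ with $\operatorname{rk}(\tilde\xi)=n+r$ such that $N(P,\tilde\xi):=(T^{n+r}\times P)/\sim$, formed from $\tilde\xi$ in the same way, admits a smooth structure making it a locally $r$-standard $T$-manifold of dimension $2n+r$, and $M(P,\xi)$ is homeomorphic to $N(P,\tilde\xi)\times T^{k-r}$. -/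

import Mathlib

open scoped Manifold ContDiff

noncomputable section

namespace ToricTopology

/-! ### Simple polytopes -/

section Polytope

variable {E : Type*} [NormedAddCommGroup E] [NormedSpace ℝ E]

/-- The dimension of (the affine hull of) a subset of a real vector space. -/
def affDim (S : Set E) : ℕ := Module.finrank ℝ (vectorSpan ℝ S)

/-- A (nonempty, convex) polytope: a bounded intersection of finitely many closed half-spaces. -/
structure IsPolytope (P : Set E) : Prop where
  nonempty : P.Nonempty
  isBounded : Bornology.IsBounded P
  exists_halfSpaces : ∃ (m : ℕ) (a : Fin m → (E →L[ℝ] ℝ)) (b : Fin m → ℝ),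
    P = {x | ∀ i, a i x ≤ b i}

/-- A facet of `P`: a nonempty face of codimension one.  A nonempty face is the set of points
at which some linear functional attains its maximum over `P`. -/
structure IsFacet (P F : Set E) : Prop where
  nonempty : F.Nonempty
  isExposed : IsExposed ℝ P F
  affDim_add_one : affDim F + 1 = affDim P

/-- The set `𝓕(P)` of facets of `P`. -/
def Facet (P : Set E) : Type _ := {F : Set E // IsFacet P F}

/-- An `n`-dimensional simple polytope: every vertex lies in exactly `n` facets. -/
structure IsSimplePolytope (n : ℕ) (P : Set E) : Prop where
  isPolytope : IsPolytope P
  affDim_eq : affDim P = n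
  encard_facets : ∀ v ∈ P.extremePoints ℝ, {F : Set E | IsFacet P F ∧ v ∈ F}.encard = n

end Polytope

/-! ### Tori -/

/-- The compact torus `T^N = (S¹)^N`. -/
abbrev Torus (N : ℕ) : Type := Fin N → Circle

/-- The homomorphism `S¹ → T^N`, `s ↦ (s ^ a₁, …, s ^ a_N)`, given by `a ∈ ℤ^N`. -/
def oneParam {N : ℕ} (a : Fin N → ℤ) : Circle →* Torus N where
  toFun s j := s ^ a j
  map_one' := by ext j; simp
  map_mul' s t := by funext j; exact mul_zpow s t (a j)

/-! ### Hyper characteristic functions and the spaces `M(P, ξ)` -/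

section CharSpace

variable {E : Type*} [NormedAddCommGroup E] [NormedSpace ℝ E] {P : Set E}

/-- `ξ : 𝓕(P) → ℤ^(n+k)` is a (generalized) hyper characteristic function: whenever `n` distinct
facets have a common point, their `ξ`-vectors are, as a family, part of a `ℤ`-basis
of `ℤ^(n+k)`. -/
def IsHyperCharacteristic (n k : ℕ) (ξ : Facet P → Fin (n + k) → ℤ) : Prop :=
  ∀ F : Fin n → Facet P, Function.Injective F → (⋂ i, (F i).1).Nonempty →
    ∃ (b : Module.Basis (Fin (n + k)) ℤ (Fin (n + k) → ℤ)) (e : Fin n ↪ Fin (n + k)),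
      ∀ i, b (e i) = ξ (F i)

/-- `rk ξ`: the rank of the subgroup of `ℤ^N` generated by the values of `ξ`. -/
def rk {N : ℕ} (ξ : Facet P → Fin N → ℤ) : ℕ :=
  Module.finrank ℤ (Submodule.span ℤ (Set.range ξ))

/-- The subgroup `T_x` of `T^N` generated by the circles belonging to the vectors `ξ(F)`, where
`F` runs over the facets containing `x`.  (It is trivial if `x` lies in no facet.) -/
def isotropy {N : ℕ} (ξ : Facet P → Fin N → ℤ) (x : E) : Subgroup (Torus N) :=
  ⨆ F : {F : Facet P // x ∈ F.1}, (oneParam (ξ F.1)).range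

/-- The relation `(t, p) ∼ (s, q) ↔ p = q ∧ t⁻¹ s ∈ T_p` on `T^N × P`. -/
def charSetoid {N : ℕ} (ξ : Facet P → Fin N → ℤ) : Setoid (Torus N × P) where
  r u v := u.2 = v.2 ∧ u.1⁻¹ * v.1 ∈ isotropy ξ u.2
  iseqv :=
    { refl := fun u => ⟨rfl, by simp [one_mem]⟩
      symm := by
        rintro ⟨t, p⟩ ⟨s, q⟩ ⟨h, h'⟩
        dsimp only at h h' ⊢
        subst h
        exact ⟨rfl, by simpa using inv_mem h'⟩
      trans := by
        rintro ⟨t, p⟩ ⟨s, q⟩ ⟨u, w⟩ ⟨h, h'⟩ ⟨g, g'⟩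
        dsimp only at h h' g g' ⊢
        subst h
        subst g
        exact ⟨rfl, by simpa [mul_assoc] using mul_mem h' g'⟩ }

/-- The identification space `M(P, ξ) = (T^N × P) / ∼`. -/
def CharSpace {N : ℕ} (ξ : Facet P → Fin N → ℤ) : Type _ := Quotient (charSetoid ξ)

/-- `M(P, ξ)` carries the quotient topology. -/
instance {N : ℕ} (ξ : Facet P → Fin N → ℤ) : TopologicalSpace (CharSpace ξ) :=
  inferInstanceAs (TopologicalSpace (Quotient (charSetoid ξ)))

/-- `T^N` acts on `M(P, ξ)` by multiplication on the first factor of `T^N × P`. -/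
instance {N : ℕ} (ξ : Facet P → Fin N → ℤ) : MulAction (Torus N) (CharSpace ξ) where
  smul g := Quotient.map (fun u => (g * u.1, u.2)) (by
    rintro ⟨t, p⟩ ⟨s, q⟩ ⟨h, h'⟩
    dsimp only at h h'
    refine ⟨h, ?_⟩
    have e : (g * t)⁻¹ * (g * s) = t⁻¹ * s := by group
    simpa only [e] using h')
  one_smul x := by
    induction x using Quotient.inductionOn with
    | h u => exact congrArg (Quotient.mk _) (Prod.ext (one_mul u.1) rfl)
  mul_smul g h x := by
    induction x using Quotient.inductionOn with
    | h u => exact congrArg (Quotient.mk _) (Prod.ext (mul_assoc g h u.1) rfl)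

end CharSpace

/-! ### Locally standard torus manifolds -/

/-- The standard action of `T^N` on `ℂ^N`. -/
def stdAct {N : ℕ} (t : Torus N) (z : Fin N → ℂ) : Fin N → ℂ := fun j => (t j : ℂ) * z j

/-- The invariant subset `ℂ^n × T^k` of `ℂ^(n+k)`. -/
def stdModel (n k : ℕ) : Set (Fin (n + k) → ℂ) := {z | ∀ j : Fin k, ‖z (Fin.natAdd n j)‖ = 1}

/-- A locally `k`-standard `T`-manifold of dimension `2n + k`: a smooth (Hausdorff, second
countable) manifold of dimension `2n + k` with an effective action of `T^(n+k)`, such that each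
point has an open invariant neighbourhood `U` which, for some (topological) automorphism `θ` of
the torus, is `θ`-equivariantly diffeomorphic to a (relatively) open subset of the
submanifold `ℂ^n × T^k` of `ℂ^(n+k)`.  The maps `φ` and `ψ` are the diffeomorphism and its inverse;
smoothness of `ψ` on the locally closed submanifold `φ '' U` is smoothness within this subset of
`ℂ^(n+k)`.  That the action is smooth follows from the local description. -/
structure IsLocallyStandardManifold (n k : ℕ) (M : Type*) [TopologicalSpace M]
    [MulAction (Torus (n + k)) M] [ChartedSpace (EuclideanSpace ℝ (Fin (2 * n + k))) M] :
    Prop where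
  t2Space : T2Space M
  secondCountable : SecondCountableTopology M
  isManifold : IsManifold (𝓡 (2 * n + k)) ∞ M
  effective : FaithfulSMul (Torus (n + k)) M
  locallyStandard : ∀ p : M, ∃ (θ : Torus (n + k) ≃ₜ* Torus (n + k)) (U : Set M)
    (φ : M → Fin (n + k) → ℂ) (ψ : (Fin (n + k) → ℂ) → M),
    IsOpen U ∧ p ∈ U ∧ (∀ (t : Torus (n + k)), ∀ x ∈ U, t • x ∈ U) ∧
    (∃ O : Set (Fin (n + k) → ℂ), IsOpen O ∧ φ '' U = O ∩ stdModel n k) ∧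
    (∀ x ∈ U, ψ (φ x) = x) ∧
    ContMDiffOn (𝓡 (2 * n + k)) 𝓘(ℝ, Fin (n + k) → ℂ) ∞ φ U ∧
    ContMDiffOn 𝓘(ℝ, Fin (n + k) → ℂ) (𝓡 (2 * n + k)) ∞ ψ (φ '' U) ∧
    (∀ (t : Torus (n + k)), ∀ x ∈ U, φ (t • x) = stdAct (θ t) (φ x))

/-- The space `M`, with its given topology and torus action, has a smooth structure that makes it
a locally `k`-standard `T`-manifold of dimension `2n + k`. -/
def AdmitsLocallyStandardStructure (n k : ℕ) (M : Type*) [TopologicalSpace M]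
    [MulAction (Torus (n + k)) M] : Prop :=
  ∃ _ : ChartedSpace (EuclideanSpace ℝ (Fin (2 * n + k))) M, IsLocallyStandardManifold n k M

end ToricTopology

end

open scoped Manifold ContDiff

noncomputable section

namespace ToricTopology

/-! ### Facets of a polytope -/

section PolytopeFacets

variable {E : Type*} [NormedAddCommGroup E] [NormedSpace ℝ E]

/-! Forward direction. If `rk ξ = n + r`, a basis of `ℤ^(n+k)` adapted to the span of the values
(Smith normal form) moves all values into the first `n + r` coordinates. A change of basis is an
automorphism of the torus, and the remaining `k - r` circles meet every isotropy group trivially, so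
they split off as a factor `T^(k-r)` (`nonempty_homeomorph_prod_torus`). The reduced function is
again hyper characteristic, because coordinate functionals dual to the values at `n` meeting facets
restrict to the smaller lattice and split it (`exists_reduction`).

Smooth structure. At a vertex `v` of a simple polytope the defining functions `d_i` of the `n`
facets through `v` are affine coordinates, and in a lattice basis extending the values of `ξ` at `v`
the isotropy groups over the open star of `v` are coordinate subtori. Hence `(t, p) ↦ (t_i
√d_i(p))`, completed by the last `r` circle coordinates, identifies the part of the space over the
star with an open subset of `ℂ^n × T^r`. On overlaps a coordinate that can vanish belongs to a facet
shared by both vertices and is merely multiplied by smooth nonvanishing factors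
(`CharAtlas.contDiffWithinAt_transition`). The polyhedral input is that facet inequalities cut out
`P` in its affine hull (`polyhedron_facet_separates`).

Converse. The rank is a topological invariant (`rk_eq_of_homeomorph`): the characters of `T^N` that
kill the values of `ξ` form a lattice of rank `N - rk ξ`, which is in effect the group of homotopy
classes of maps `M(P, ξ) → S¹`. This is proved with degrees of lifts to the contractible space `ℝ^N
× P`. It remains to compare `ξ` with `ξ'` padded by zeros, whose space is `N(P, ξ') × T^(k-r)`. -/

theorem exists_pos_forall_mul_abs_le {ι : Type*} [Finite ι] (c s : ι → ℝ)
    (h : ∀ i, 0 ≤ s i ∧ (s i = 0 → c i = 0)) : ∃ ε > 0, ∀ i, ε * |c i| ≤ s i := by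
  have key : ∀ᶠ ε in nhdsWithin (0 : ℝ) (Set.Ioi 0), ∀ i, ε * |c i| ≤ s i := by
    rw [Filter.eventually_all]
    intro i
    rcases (h i).1.eq_or_lt with h0 | h0
    · simp [(h i).2 h0.symm, ← h0]
    · have : Filter.Tendsto (fun ε : ℝ => ε * |c i|) (nhdsWithin 0 (Set.Ioi 0)) (nhds 0) := by
        have : Continuous fun ε : ℝ => ε * |c i| := by fun_prop
        simpa using (this.tendsto 0).mono_left nhdsWithin_le_nhds
      filter_upwards [this.eventually_lt_const h0] with ε hε using hε.le
  obtain ⟨ε, h1, h2⟩ := (key.and self_mem_nhdsWithin).exists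
  exact ⟨ε, h2, h1⟩

theorem mem_vectorSpan_of_add_smul_mem {F : Set E} {x w : E} {ε : ℝ} (hε : ε ≠ 0) (hx : x ∈ F)
    (h : x + ε • w ∈ F) : w ∈ vectorSpan ℝ F := by
  have := vsub_mem_vectorSpan ℝ h hx
  rw [vsub_eq_sub, add_sub_cancel_left] at this
  exact (Submodule.smul_mem_iff _ hε).1 this

theorem vectorSpan_le_iff {F : Set E} {W : Submodule ℝ E} :
    vectorSpan ℝ F ≤ W ↔ ∀ x ∈ F, ∀ y ∈ F, x - y ∈ W := by
  rw [vectorSpan_def, Submodule.span_le]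
  constructor
  · intro h x hx y hy
    exact h (Set.vsub_mem_vsub hx hy)
  · rintro h _ ⟨x, hx, y, hy, rfl⟩
    exact h x hx y hy

/-- The polyhedron cut out by the inequalities `a i x ≤ b i`. -/
def polyhedron {m : ℕ} (a : Fin m → (E →L[ℝ] ℝ)) (b : Fin m → ℝ) : Set E := {x | ∀ i, a i x ≤ b i}

/-! ### Active inequalities, faces and directions of a polyhedron. -/

section polyhedron

variable {m : ℕ} {a : Fin m → (E →L[ℝ] ℝ)} {b : Fin m → ℝ}

theorem exists_pos_add_smul_mem {x w : E} (hx : x ∈ polyhedron a b)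
    (h : ∀ i, a i x = b i → a i w = 0) :
    ∃ ε : ℝ, 0 < ε ∧ x + ε • w ∈ polyhedron a b ∧ x - ε • w ∈ polyhedron a b := by
  obtain ⟨ε, h0, hε⟩ := exists_pos_forall_mul_abs_le (fun i => a i w) (fun i => b i - a i x)
    (fun i => ⟨by linarith [hx i], fun hi => h i (by linarith)⟩)
  refine ⟨ε, h0, fun i => ?_, fun i => ?_⟩
  · have h1 := hε i
    have h2 := mul_le_mul_of_nonneg_left (le_abs_self (a i w)) h0.le
    simp only [map_add, map_smul, smul_eq_mul]
    linarith
  · have h1 := hε i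
    have h2 := mul_le_mul_of_nonneg_left (neg_abs_le (a i w)) h0.le
    simp only [map_sub, map_smul, smul_eq_mul]
    linarith

/-- A relative interior point: a midpoint makes an inequality tight only if both endpoints do, so
averaging with suitable points removes every tightness that is not forced on all of the polyhedron.
-/
theorem exists_generic_mem (hne : (polyhedron a b).Nonempty) :
    ∃ x ∈ polyhedron a b, ∀ i, a i x = b i → ∀ y ∈ polyhedron a b, a i y = b i := by
  suffices H : ∀ s : Finset (Fin m), ∃ x ∈ polyhedron a b, ∀ i ∈ s, a i x = b i →
      ∀ y ∈ polyhedron a b, a i y = b i by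
    obtain ⟨x, hx, h⟩ := H Finset.univ
    exact ⟨x, hx, fun i => h i (Finset.mem_univ i)⟩
  intro s
  induction s using Finset.induction_on with
  | empty => exact ⟨hne.some, hne.some_mem, by simp⟩
  | insert j s _ ih =>
    obtain ⟨x, hx, h⟩ := ih
    by_cases hj : ∀ y ∈ polyhedron a b, a j y = b j
    · refine ⟨x, hx, fun i hi => ?_⟩
      rcases Finset.mem_insert.1 hi with rfl | hi
      · exact fun _ => hj
      · exact h i hi
    · push Not at hj
      obtain ⟨y, hy, hyj⟩ := hj
      have hval : ∀ i, a i ((1 / 2 : ℝ) • (x + y)) = (a i x + a i y) / 2 := fun i => by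
        simp only [map_smul, map_add, smul_eq_mul]; ring
      refine ⟨(1 / 2 : ℝ) • (x + y), fun i => ?_, fun i hi e => ?_⟩
      · rw [hval]; linarith [hx i, hy i]
      · rw [hval] at e
        have h1 := hx i
        have h2 := hy i
        rcases Finset.mem_insert.1 hi with rfl | hi
        · exact absurd (by linarith) hyj
        · exact h i hi (by linarith)

theorem mem_vectorSpan_polyhedron {x₀ : E} (hx₀ : x₀ ∈ polyhedron a b)
    (hgen : ∀ i, a i x₀ = b i → ∀ y ∈ polyhedron a b, a i y = b i) {w : E} :
    w ∈ vectorSpan ℝ (polyhedron a b) ↔ ∀ i, a i x₀ = b i → a i w = 0 := by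
  constructor
  · intro hw i hi
    have : vectorSpan ℝ (polyhedron a b) ≤ LinearMap.ker (a i : E →ₗ[ℝ] ℝ) := by
      rw [vectorSpan_le_iff]
      intro x hx y hy
      simp [hgen i hi x hx, hgen i hi y hy]
    exact this hw
  · intro h
    obtain ⟨ε, h0, h1, -⟩ := exists_pos_add_smul_mem hx₀ h
    exact mem_vectorSpan_of_add_smul_mem h0.ne' hx₀ h1

/-- The segment from `y` to `x` can be prolonged slightly beyond `x` inside the polyhedron, so a
functional maximal at `x` cannot be smaller at `y`. Thus an exposed face is determined by the active
sets of its points. -/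
theorem mem_of_isExposed {F : Set E} (hF : IsExposed ℝ (polyhedron a b) F) {x y : E} (hx : x ∈ F)
    (hy : y ∈ polyhedron a b) (h : ∀ i, a i x = b i → a i y = b i) : y ∈ F := by
  obtain ⟨l, hl⟩ := hF ⟨x, hx⟩
  rw [hl] at hx ⊢
  refine ⟨hy, fun z hz => (hx.2 z hz).trans ?_⟩
  obtain ⟨ε, h0, -, h1⟩ := exists_pos_add_smul_mem (w := y - x) hx.1 (fun i hi => by
    rw [map_sub, h i hi, hi, sub_self])
  have := hx.2 _ h1
  simp only [map_sub, map_smul, smul_eq_mul] at this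
  have h2 : 0 ≤ ε * (l y - l x) := by linarith
  have := nonneg_of_mul_nonneg_right h2 h0
  linarith

theorem finite_facet_polyhedron : Finite (Facet (polyhedron a b)) := by
  refine Finite.of_injective
    (fun F : Facet (polyhedron a b) => {s : Set (Fin m) | ∃ x ∈ F.1, s = {i | a i x = b i}}) ?_
  have key : ∀ F G : Facet (polyhedron a b),
      {s : Set (Fin m) | ∃ x ∈ F.1, s = {i | a i x = b i}} ⊆
        {s : Set (Fin m) | ∃ x ∈ G.1, s = {i | a i x = b i}} → F.1 ⊆ G.1 := by
    intro F G h x hx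
    obtain ⟨y, hy, e⟩ := h ⟨x, hx, rfl⟩
    refine mem_of_isExposed G.2.isExposed hy (F.2.isExposed.subset hx) fun i hi => ?_
    have : i ∈ {i | a i y = b i} := hi
    rwa [← e] at this
  intro F G h
  exact Subtype.ext ((key F G h.subset).antisymm (key G F h.symm.subset))

end polyhedron

namespace Facet

variable {P : Set E}

theorem exists_functional (F : Facet P) :
    ∃ l : E →L[ℝ] ℝ, F.1 = {x | x ∈ P ∧ ∀ y ∈ P, l y ≤ l x} :=
  F.2.isExposed F.2.nonempty

/-- A linear functional whose maximum over `P` is attained exactly on the facet `F`. -/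
def functional (F : Facet P) : E →L[ℝ] ℝ := F.exists_functional.choose

/-- The affine function vanishing on the facet `F` and positive on the rest of `P`. -/
def defect (F : Facet P) (x : E) : ℝ := F.functional F.2.nonempty.some - F.functional x

theorem mem_iff {F : Facet P} {x : E} :
    x ∈ F.1 ↔ x ∈ P ∧ ∀ y ∈ P, F.functional y ≤ F.functional x :=
  Set.ext_iff.1 F.exists_functional.choose_spec x

theorem defect_nonneg (F : Facet P) {x : E} (hx : x ∈ P) : 0 ≤ F.defect x :=
  sub_nonneg.2 ((mem_iff.1 F.2.nonempty.some_mem).2 x hx)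

theorem defect_eq_zero_iff (F : Facet P) {x : E} (hx : x ∈ P) : F.defect x = 0 ↔ x ∈ F.1 := by
  have h := mem_iff.1 F.2.nonempty.some_mem
  constructor
  · intro h0
    refine mem_iff.2 ⟨hx, fun y hy => (h.2 y hy).trans (sub_eq_zero.1 h0).le⟩
  · intro h1
    exact le_antisymm (sub_nonpos.2 ((mem_iff.1 h1).2 _ h.1)) (F.defect_nonneg hx)

theorem defect_add (F : Facet P) (x w : E) : F.defect (x + w) = F.defect x - F.functional w := by
  simp only [defect, map_add]; ring

end Facet

/-- In an irredundant subsystem of the inequalities, each one defines a facet. The functional chosen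
for that facet vanishes on the same hyperplane of directions, hence is a positive multiple of the
inequality on the direction space, and a point violating the inequality has negative defect. -/
theorem polyhedron_facet_separates [FiniteDimensional ℝ E] {m : ℕ} {a : Fin m → (E →L[ℝ] ℝ)}
    {b : Fin m → ℝ} {x₀ : E} (hx₀ : x₀ ∈ polyhedron a b)
    {x : E} (hx : x - x₀ ∈ vectorSpan ℝ (polyhedron a b))
    (h : ∀ F : Facet (polyhedron a b), 0 ≤ F.defect x) : x ∈ polyhedron a b := by
  classical
  by_contra hxP
  obtain ⟨x₁, hx₁, hgen⟩ := exists_generic_mem ⟨x₀, hx₀⟩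
  set V := vectorSpan ℝ (polyhedron a b) with hV
  have hVmem : ∀ {w}, w ∈ V ↔ ∀ i, a i x₁ = b i → a i w = 0 :=
    mem_vectorSpan_polyhedron hx₁ hgen
  have hx' : x - x₁ ∈ V := by
    have := V.add_mem hx (vsub_mem_vectorSpan ℝ hx₀ hx₁)
    simpa using this
  -- `J` is a minimal set of inequalities that still cuts out the polyhedron within its affine hull;
  -- minimality supplies, for each `i ∈ J`, a point violating only the `i`-th one.
  obtain ⟨J, hJ, hmin⟩ := (Set.toFinite {J : Finset (Fin m) | ∀ y, y - x₁ ∈ V →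
    (∀ i ∈ J, a i y ≤ b i) → y ∈ polyhedron a b}).exists_minimal
    ⟨Finset.univ, fun y _ hy i => hy i (Finset.mem_univ i)⟩
  have hex : ∀ i ∈ J, ∃ y, y - x₁ ∈ V ∧ (∀ j ∈ J, j ≠ i → a j y ≤ b j) ∧ b i < a i y := by
    intro i hi
    have : J.erase i ∉ {J : Finset (Fin m) | ∀ y, y - x₁ ∈ V →
        (∀ i ∈ J, a i y ≤ b i) → y ∈ polyhedron a b} := fun hmem =>
      (J.notMem_erase i) (hmin hmem (J.erase_subset i) hi)
    simp only [Set.mem_ofPred_eq, not_forall] at this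
    obtain ⟨y, hy, hyJ, hyP⟩ := this
    refine ⟨y, hy, fun j hj hji => hyJ j (Finset.mem_erase.2 ⟨hji, hj⟩), ?_⟩
    by_contra hle
    refine hyP (hJ y hy fun j hj => ?_)
    by_cases hji : j = i
    · rw [hji]; exact not_lt.1 hle
    · exact hyJ j (Finset.mem_erase.2 ⟨hji, hj⟩)
  have hlt : ∀ i ∈ J, a i x₁ < b i := by
    intro i hi
    refine lt_of_le_of_ne (hx₁ i) fun e => ?_
    obtain ⟨y, hy, -, hy2⟩ := hex i hi
    have := hVmem.1 hy i e
    rw [map_sub, e] at this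
    linarith
  obtain ⟨i, hi, hxi⟩ : ∃ i ∈ J, b i < a i x := by
    by_contra hcon
    push Not at hcon
    exact hxP (hJ x hx' hcon)
  obtain ⟨y, hy, hyJ, hyi⟩ := hex i hi
  have hden : 0 < a i y - a i x₁ := by linarith [hlt i hi]
  -- `t` is the parameter at which the segment from the relative interior point `x₁` to the
  -- violating point `y` crosses `a i = b i`; all other inequalities of `J` are strict there.
  set t := (b i - a i x₁) / (a i y - a i x₁) with ht
  have ht0 : 0 < t := div_pos (by linarith [hlt i hi]) hden
  have ht1 : t < 1 := (div_lt_one hden).2 (by linarith)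
  set z := x₁ + t • (y - x₁) with hz
  have hzV : z - x₁ ∈ V := by
    rw [hz, add_sub_cancel_left]; exact V.smul_mem _ hy
  have hzi : a i z = b i := by
    simp only [hz, map_add, map_smul, map_sub, smul_eq_mul, ht]
    field_simp
    ring
  have hzj : ∀ j ∈ J, j ≠ i → a j z < b j := by
    intro j hj hji
    have h1 := hlt j hj
    have h2 := hyJ j hj hji
    have e : a j z = (1 - t) * a j x₁ + t * a j y := by
      simp only [hz, map_add, map_smul, map_sub, smul_eq_mul]; ring
    rw [e]
    nlinarith [mul_lt_mul_of_pos_left h1 (sub_pos.2 ht1), mul_le_mul_of_nonneg_left h2 ht0.le]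
  have hzP : z ∈ polyhedron a b := hJ z hzV fun j hj => by
    by_cases hji : j = i
    · rw [hji, hzi]
    · exact (hzj j hj hji).le
  set F : Set E := {p | p ∈ polyhedron a b ∧ a i p = b i} with hF
  have hspan : ∀ w ∈ V, a i w = 0 → w ∈ vectorSpan ℝ F := by
    intro w hw hw0
    obtain ⟨ε, h0, hε⟩ := exists_pos_forall_mul_abs_le
      (fun j : J => a j w) (fun j : J => b j - a j z) (fun j => by
        by_cases hji : j.1 = i
        · simp [hji, hzi, hw0]
        · have := hzj j j.2 hji
          exact ⟨by linarith, fun h => by linarith⟩)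
    refine mem_vectorSpan_of_add_smul_mem (x := z) h0.ne' ⟨hzP, hzi⟩ ⟨hJ _ ?_ ?_, ?_⟩
    · rw [add_sub_right_comm]; exact V.add_mem hzV (V.smul_mem _ hw)
    · intro j hj
      have h1 := hε ⟨j, hj⟩
      have h2 := mul_le_mul_of_nonneg_left (le_abs_self (a j w)) h0.le
      simp only [map_add, map_smul, smul_eq_mul]
      dsimp only at h1
      linarith
    · simp [hzi, hw0]
  have hspan' : vectorSpan ℝ F = V ⊓ LinearMap.ker (a i : E →ₗ[ℝ] ℝ) := by
    apply le_antisymm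
    · rw [vectorSpan_le_iff]
      rintro p ⟨hp, hpi⟩ q ⟨hq, hqi⟩
      exact ⟨vsub_mem_vectorSpan ℝ hp hq, by simp [hpi, hqi]⟩
    · rintro w ⟨hw, hw0⟩
      exact hspan w hw hw0
  have hyx : y - x₁ ∈ V ∧ a i (y - x₁) ≠ 0 := ⟨hy, by rw [map_sub]; exact hden.ne'⟩
  have hdim : affDim F + 1 = affDim (polyhedron a b) := by
    unfold affDim
    rw [hspan', ← hV]
    have h1 := LinearMap.finrank_range_add_finrank_ker ((a i : E →ₗ[ℝ] ℝ).domRestrict V)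
    have h2 : LinearMap.range ((a i : E →ₗ[ℝ] ℝ).domRestrict V) = ⊤ := by
      apply LinearMap.range_eq_top.2
      apply LinearMap.surjective
      intro h0
      exact hyx.2 (LinearMap.congr_fun h0 ⟨_, hyx.1⟩)
    have h3 : Module.finrank ℝ (LinearMap.ker ((a i : E →ₗ[ℝ] ℝ).domRestrict V)) =
        Module.finrank ℝ (V ⊓ LinearMap.ker (a i : E →ₗ[ℝ] ℝ) : Submodule ℝ E) := by
      rw [LinearMap.ker_domRestrict, ← Submodule.map_comap_subtype]
      exact (LinearEquiv.finrank_eq (Submodule.equivMapOfInjective _ V.injective_subtype _))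
    rw [h2, finrank_top, Module.finrank_self, h3] at h1
    omega
  have hFac : IsFacet (polyhedron a b) F := by
    refine ⟨⟨z, hzP, hzi⟩, fun _ => ⟨a i, ?_⟩, hdim⟩
    ext p
    constructor
    · rintro ⟨hp, hpi⟩
      exact ⟨hp, fun q hq => by rw [hpi]; exact hq i⟩
    · rintro ⟨hp, hpm⟩
      exact ⟨hp, le_antisymm (hp i) (hzi ▸ hpm z hzP)⟩
  set G : Facet (polyhedron a b) := ⟨F, hFac⟩ with hG
  have hzG : z ∈ G.1 := ⟨hzP, hzi⟩
  have hx₁G : x₁ ∉ G.1 := fun hmem => (hlt i hi).ne hmem.2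
  have hl0 : ∀ w ∈ V, a i w = 0 → G.functional w = 0 := by
    intro w hw hw0
    have hle : vectorSpan ℝ F ≤ LinearMap.ker (G.functional : E →ₗ[ℝ] ℝ) := by
      rw [vectorSpan_le_iff]
      intro p hp q hq
      have hp' := Facet.mem_iff.1 (show p ∈ G.1 from hp)
      have hq' := Facet.mem_iff.1 (show q ∈ G.1 from hq)
      simp [le_antisymm (hq'.2 p hp'.1) (hp'.2 q hq'.1)]
    exact hle (hspan w hw hw0)
  have hd1 : 0 < G.defect x₁ :=
    lt_of_le_of_ne (G.defect_nonneg hx₁) fun e => hx₁G ((G.defect_eq_zero_iff hx₁).1 e.symm)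
  have hdz : G.defect z = 0 := (G.defect_eq_zero_iff hzP).2 hzG
  have hly : 0 < G.functional (y - x₁) := by
    rw [hz, Facet.defect_add, map_smul, smul_eq_mul] at hdz
    have : 0 < t * G.functional (y - x₁) := by linarith
    exact pos_of_mul_pos_right this ht0.le
  -- With this `s`, the vector `x - z` differs from `s • (y - x₁)` by a direction along the facet,
  -- so the defect at `x` is `-s` times a positive number.
  set s := (a i x - b i) / (a i (y - x₁)) with hs
  have hyx0 : 0 < a i (y - x₁) := by rw [map_sub]; exact hden
  have hs0 : 0 < s := div_pos (by linarith) hyx0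
  have hw : G.functional (x - z - s • (y - x₁)) = 0 := by
    apply hl0
    · have e : x - z = (x - x₁) - (z - x₁) := by abel
      rw [e]
      exact V.sub_mem (V.sub_mem hx' hzV) (V.smul_mem _ hy)
    · rw [map_sub, map_sub, map_smul, hzi, smul_eq_mul, hs, div_mul_cancel₀ _ hyx0.ne', sub_self]
  have hfin := h G
  have e : x = z + ((x - z - s • (y - x₁)) + s • (y - x₁)) := by abel
  rw [e, Facet.defect_add, hdz, map_add, hw, map_smul, smul_eq_mul] at hfin
  nlinarith [mul_pos hs0 hly]

end PolytopeFacets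

/-! ### Coordinates near the vertices of a simple polytope -/

/-- Affine functions defining the facets of `P`, together with affine coordinates of `P` at a set
of vertices that covers `P` by open stars. -/
structure FacetAtlas {E : Type*} [NormedAddCommGroup E] [NormedSpace ℝ E] (n : ℕ) (P : Set E) where
  /-- the defining function of a facet -/
  d : Facet P → E → ℝ
  contDiff_d : ∀ F, ContDiff ℝ ∞ (d F)
  nonneg_d : ∀ F, ∀ x ∈ P, 0 ≤ d F x
  d_eq_zero_iff : ∀ F, ∀ x ∈ P, d F x = 0 ↔ x ∈ F.1
  /-- the facets at a vertex -/
  facet : P.extremePoints ℝ → Fin n → Facet P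
  facet_injective : ∀ v, Function.Injective (facet v)
  mem_facet : ∀ v i, v.1 ∈ (facet v i).1
  /-- the affine parametrization at a vertex -/
  param : P.extremePoints ℝ → (Fin n → ℝ) → E
  contDiff_param : ∀ v, ContDiff ℝ ∞ (param v)
  d_param : ∀ v y j, d (facet v j) (param v y) = y j
  param_d : ∀ v, ∀ p ∈ P, param v (fun j => d (facet v j) p) = p
  param_mem : ∀ v y, (∀ F, 0 ≤ d F (param v y)) → param v y ∈ P
  exists_vertex : ∀ p ∈ P, ∃ v, ∀ F : Facet P, p ∈ F.1 → F ∈ Set.range (facet v)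
  exists_interior : ∃ p ∈ P, ∀ F : Facet P, p ∉ F.1

section SimplePolytope

variable {E : Type*} [NormedAddCommGroup E] [NormedSpace ℝ E] {P : Set E} {n : ℕ}

theorem IsPolytope.exists_eq_polyhedron (hP : IsPolytope P) :
    ∃ (m : ℕ) (a : Fin m → (E →L[ℝ] ℝ)) (b : Fin m → ℝ), P = polyhedron a b :=
  hP.exists_halfSpaces

theorem IsPolytope.finite_facet (hP : IsPolytope P) : Finite (Facet P) := by
  obtain ⟨m, a, b, rfl⟩ := hP.exists_eq_polyhedron
  exact finite_facet_polyhedron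

theorem IsPolytope.convex (hP : IsPolytope P) : Convex ℝ P := by
  obtain ⟨m, a, b, rfl⟩ := hP.exists_eq_polyhedron
  have : polyhedron a b = ⋂ i, {x | a i x ≤ b i} := by ext; simp [polyhedron]
  rw [this]
  exact convex_iInter fun i => convex_halfSpace_le (a i).isLinear (b i)

theorem IsPolytope.exists_forall_notMem_facet (hP : IsPolytope P) :
    ∃ p ∈ P, ∀ F : Facet P, p ∉ F.1 := by
  obtain ⟨m, a, b, rfl⟩ := hP.exists_eq_polyhedron
  obtain ⟨x, hx, h⟩ := exists_generic_mem hP.nonempty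
  refine ⟨x, hx, fun F hF => ?_⟩
  have : F.1 = polyhedron a b := F.2.isExposed.subset.antisymm fun y hy =>
    mem_of_isExposed F.2.isExposed hF hy fun i hi => h i hi y hy
  have h1 := F.2.affDim_add_one
  rw [this] at h1
  omega

theorem IsSimplePolytope.exists_facets_equiv (hP : IsSimplePolytope n P) {v : E}
    (hv : v ∈ P.extremePoints ℝ) :
    ∃ f : Fin n → Facet P, Function.Injective f ∧ ∀ F : Facet P, v ∈ F.1 ↔ F ∈ Set.range f := by
  have h := hP.encard_facets v hv
  have hfin : {F : Set E | IsFacet P F ∧ v ∈ F}.Finite := Set.finite_of_encard_eq_coe h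
  have hcard : Nat.card {F : Set E | IsFacet P F ∧ v ∈ F} = n := by
    rw [Nat.card_coe_set_eq, Set.ncard, h]; rfl
  have := hfin.to_subtype
  set e := (Finite.equivFinOfCardEq hcard).symm with he
  refine ⟨fun i => ⟨(e i).1, (e i).2.1⟩, fun i j hij => ?_, fun F => ⟨fun hF => ?_, ?_⟩⟩
  · exact e.injective (Subtype.ext (congrArg (fun F : Facet P => F.1) hij))
  · refine ⟨e.symm ⟨F.1, F.2, hF⟩, Subtype.ext ?_⟩
    simp only [Equiv.apply_symm_apply]
  · rintro ⟨i, rfl⟩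
    exact (e i).2.2

variable [FiniteDimensional ℝ E]

theorem IsPolytope.isCompact (hP : IsPolytope P) : IsCompact P := by
  have := FiniteDimensional.proper ℝ E
  refine Metric.isCompact_of_isClosed_isBounded ?_ hP.isBounded
  obtain ⟨m, a, b, rfl⟩ := hP.exists_eq_polyhedron
  have : polyhedron a b = ⋂ i, {x | a i x ≤ b i} := by ext; simp [polyhedron]
  rw [this]
  exact isClosed_iInter fun i => isClosed_le (a i).continuous continuous_const

/-- The points satisfying every equality active at `p` form a compact extreme subset; by
Krein–Milman it has an extreme point, which is then a vertex of `P`. -/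
theorem IsPolytope.exists_extremePoint (hP : IsPolytope P) {p : E} (hp : p ∈ P) :
    ∃ v ∈ P.extremePoints ℝ, ∀ F : Facet P, p ∈ F.1 → v ∈ F.1 := by
  have hcpt := hP.isCompact
  obtain ⟨m, a, b, rfl⟩ := hP.exists_eq_polyhedron
  set G : Set E := {y | y ∈ polyhedron a b ∧ ∀ i, a i p = b i → a i y = b i} with hG
  have hGc : IsCompact G := by
    have : G = polyhedron a b ∩ ⋂ i, {y | a i p = b i → a i y = b i} := by
      ext; simp [hG]
    rw [this]
    refine hcpt.inter_right (isClosed_iInter fun i => ?_)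
    by_cases h : a i p = b i
    · simpa [h] using isClosed_eq (a i).continuous continuous_const
    · simp [h]
  obtain ⟨v, hv⟩ := hGc.extremePoints_nonempty ⟨p, hp, fun _ h => h⟩
  have hext : IsExtreme ℝ (polyhedron a b) G := by
    refine ⟨fun x hx => hx.1, ?_⟩
    rintro x hx y hy z hz ⟨s, t, hs, ht, hst, rfl⟩
    refine ⟨hx, fun i hi => ?_⟩
    have h1 := hz.2 i hi
    simp only [map_add, map_smul, smul_eq_mul] at h1
    have h2 := hx i
    have h3 := hy i
    by_contra hne
    have h4 := lt_of_le_of_ne h2 hne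
    have h5 : s * b i + t * b i = b i := by rw [← add_mul, hst, one_mul]
    nlinarith [mul_lt_mul_of_pos_left h4 hs, mul_le_mul_of_nonneg_left h3 ht.le]
  refine ⟨v, hext.extremePoints_subset_extremePoints hv, fun F hF => ?_⟩
  exact mem_of_isExposed F.2.isExposed hF hv.1.1 hv.1.2

theorem IsPolytope.mem_of_forall_defect_nonneg (hP : IsPolytope P) {x x₀ : E} (hx₀ : x₀ ∈ P)
    (hx : x - x₀ ∈ vectorSpan ℝ P) (h : ∀ F : Facet P, 0 ≤ F.defect x) : x ∈ P := by
  obtain ⟨m, a, b, rfl⟩ := hP.exists_eq_polyhedron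
  exact polyhedron_facet_separates hx₀ hx h

/-- The `n` facet functionals at a vertex form a coordinate system on the direction space, which has
dimension `n`. A direction killed by all of them could be followed both ways from `v` inside `P`,
contradicting extremality. -/
theorem IsSimplePolytope.exists_param (hP : IsSimplePolytope n P) {v : E}
    (hv : v ∈ P.extremePoints ℝ) {f : Fin n → Facet P}
    (hf : ∀ F : Facet P, v ∈ F.1 ↔ F ∈ Set.range f) :
    ∃ σ : (Fin n → ℝ) → E, ContDiff ℝ ∞ σ ∧ (∀ y j, (f j).defect (σ y) = y j) ∧
      (∀ p ∈ P, σ (fun j => (f j).defect p) = p) ∧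
      (∀ y, (∀ F : Facet P, 0 ≤ F.defect (σ y)) → σ y ∈ P) := by
  have hpoly := hP.isPolytope
  have := hpoly.finite_facet
  have hvP : v ∈ P := hv.1
  set V := vectorSpan ℝ P
  let A : V →ₗ[ℝ] (Fin n → ℝ) := LinearMap.pi fun j => (f j).functional.toLinearMap.domRestrict V
  have hA : ∀ w j, A w j = (f j).functional w := fun _ _ => rfl
  have hinj : Function.Injective A := by
    rw [← LinearMap.ker_eq_bot, LinearMap.ker_eq_bot']
    intro w hw
    obtain ⟨ε, h0, hε⟩ := exists_pos_forall_mul_abs_le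
      (fun F : Facet P => F.functional w) (fun F : Facet P => F.defect v) (fun F =>
        ⟨F.defect_nonneg hvP, fun h => by
          obtain ⟨j, rfl⟩ := (hf F).1 ((F.defect_eq_zero_iff hvP).1 h)
          rw [← hA, hw]; rfl⟩)
    have hmem : ∀ c : ℝ, |c| = ε → v + c • (w : E) ∈ P := by
      intro c hc
      refine hpoly.mem_of_forall_defect_nonneg hvP ?_ fun F => ?_
      · rw [add_sub_cancel_left]; exact V.smul_mem _ w.2
      · rw [Facet.defect_add, map_smul, smul_eq_mul]
        have h1 := hε F
        have h2 := le_abs_self (c * F.functional w)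
        rw [abs_mul, hc] at h2
        linarith
    have h1 := hmem ε (abs_of_pos h0)
    have h2 := hmem (-ε) (by rw [abs_neg, abs_of_pos h0])
    have h3 := hv.2 h1 h2 ⟨1 / 2, 1 / 2, by norm_num, by norm_num, by norm_num, by
      rw [← smul_add, neg_smul, ← sub_eq_add_neg, add_add_sub_cancel, ← two_smul ℝ v, smul_smul]
      norm_num⟩
    have h4 : ε • (w : E) = 0 := by simpa using h3
    exact Subtype.ext ((smul_eq_zero.1 h4).resolve_left h0.ne')
  have hdim : Module.finrank ℝ V = Module.finrank ℝ (Fin n → ℝ) := by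
    rw [Module.finrank_fin_fun]; exact hP.affDim_eq
  let e : V ≃ₗ[ℝ] (Fin n → ℝ) := LinearEquiv.ofInjectiveOfFinrankEq A hinj hdim
  have he : ∀ w, e w = A w := fun _ => rfl
  have hdv : ∀ j, (f j).defect v = 0 := fun j =>
    ((f j).defect_eq_zero_iff hvP).2 ((hf _).2 ⟨j, rfl⟩)
  -- The sign appears because a defect decreases when its functional increases.
  let σ : (Fin n → ℝ) → E := fun y => v + V.subtype (e.symm (-y))
  refine ⟨σ, ?_, ?_, ?_, ?_⟩
  · have h1 : ContDiff ℝ ∞ (V.subtype ∘ₗ e.symm.toLinearMap).toContinuousLinearMap :=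
      ContinuousLinearMap.contDiff _
    exact contDiff_const.add (h1.comp contDiff_neg)
  · intro y j
    rw [Facet.defect_add, hdv, Submodule.subtype_apply, ← hA, ← he, e.apply_symm_apply]
    simp
  · intro p hp
    have hpv : p - v ∈ V := vsub_mem_vectorSpan ℝ hp hvP
    have h1 : e.symm (-fun j => (f j).defect p) = ⟨p - v, hpv⟩ := by
      rw [LinearEquiv.symm_apply_eq, he]
      funext j
      have := (f j).defect_add v (p - v)
      rw [add_sub_cancel, hdv, zero_sub] at this
      rw [Pi.neg_apply, hA, this, neg_neg]
    simp only [σ, h1, Submodule.subtype_apply]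
    abel
  · intro y hy
    refine hpoly.mem_of_forall_defect_nonneg hvP ?_ hy
    simp only [σ, add_sub_cancel_left, Submodule.subtype_apply]
    exact (e.symm (-y)).2

theorem IsSimplePolytope.nonempty_facetAtlas (hP : IsSimplePolytope n P) :
    Nonempty (FacetAtlas n P) := by
  choose f hf hf' using fun v : P.extremePoints ℝ => hP.exists_facets_equiv v.2
  choose σ h1 h2 h3 h4 using fun v : P.extremePoints ℝ => hP.exists_param v.2 (hf' v)
  exact ⟨{
    d := Facet.defect
    contDiff_d := fun F => contDiff_const.sub F.functional.contDiff
    nonneg_d := fun F x hx => F.defect_nonneg hx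
    d_eq_zero_iff := fun F x hx => F.defect_eq_zero_iff hx
    facet := f
    facet_injective := hf
    mem_facet := fun v i => (hf' v _).2 ⟨i, rfl⟩
    param := σ
    contDiff_param := h1
    d_param := h2
    param_d := h3
    param_mem := h4
    exists_vertex := fun p hp => by
      obtain ⟨v, hv, h⟩ := hP.isPolytope.exists_extremePoint hp
      exact ⟨⟨v, hv⟩, fun F hF => (hf' ⟨v, hv⟩ F).1 (h F hF)⟩
    exists_interior := hP.isPolytope.exists_forall_notMem_facet }⟩

end SimplePolytope

/-! ### Homomorphisms of tori given by integer matrices -/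

section TorusMap

variable {K M N : ℕ}

/-- The homomorphism of tori given by an integer matrix. -/
def torusMap (A : Matrix (Fin M) (Fin N) ℤ) : Torus N →* Torus M where
  toFun t i := ∏ j, t j ^ A i j
  map_one' := by funext i; simp
  map_mul' s t := by funext i; simp [mul_zpow, Finset.prod_mul_distrib]

theorem torusMap_apply (A : Matrix (Fin M) (Fin N) ℤ) (t : Torus N) (i : Fin M) :
    torusMap A t i = ∏ j, t j ^ A i j := rfl

theorem oneParam_apply (a : Fin N → ℤ) (s : Circle) (j : Fin N) : oneParam a s j = s ^ a j := rfl

theorem continuous_torusMap (A : Matrix (Fin M) (Fin N) ℤ) : Continuous (torusMap A) := by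
  refine continuous_pi fun i => ?_
  simp only [torusMap_apply]
  exact continuous_finsetProd _ fun j _ => (continuous_apply j).zpow _

theorem prod_zpow_sum {G ι : Type*} [CommGroup G] (s : Finset ι) (g : G) (a : ι → ℤ) :
    g ^ (∑ i ∈ s, a i) = ∏ i ∈ s, g ^ a i := by
  classical
  induction s using Finset.induction_on with
  | empty => simp
  | insert i s hi ih => rw [Finset.sum_insert hi, Finset.prod_insert hi, zpow_add, ih]

theorem torusMap_mul (A : Matrix (Fin K) (Fin M) ℤ) (B : Matrix (Fin M) (Fin N) ℤ) (t : Torus N) :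
    torusMap (A * B) t = torusMap A (torusMap B t) := by
  funext i
  simp only [torusMap_apply, Matrix.mul_apply, prod_zpow_sum, ← Finset.prod_zpow]
  rw [Finset.prod_comm]
  exact Finset.prod_congr rfl fun j _ => Finset.prod_congr rfl fun k _ => by
    rw [← zpow_mul, mul_comm]

theorem torusMap_one (t : Torus N) : torusMap 1 t = t := by
  funext i
  rw [torusMap_apply, Finset.prod_eq_single i]
  · simp
  · intro j _ hj; simp [Matrix.one_apply_ne hj.symm]
  · simp

theorem torusMap_oneParam (A : Matrix (Fin M) (Fin N) ℤ) (a : Fin N → ℤ) (s : Circle) :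
    torusMap A (oneParam a s) = oneParam (A.mulVec a) s := by
  funext i
  simp only [torusMap_apply, oneParam_apply, Matrix.mulVec, dotProduct, prod_zpow_sum]
  exact Finset.prod_congr rfl fun j _ => by rw [← zpow_mul, mul_comm]

theorem oneParam_single_apply (i j : Fin N) (s : Circle) :
    oneParam (Pi.single i 1) s j = if j = i then s else 1 := by
  rw [oneParam_apply, Pi.single_apply]
  split_ifs <;> simp

theorem prod_oneParam_single (t : Torus N) : ∏ i, oneParam (Pi.single i 1) (t i) = t := by
  funext j
  rw [Finset.prod_apply, Finset.prod_eq_single j]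
  · simp [oneParam_single_apply]
  · intro i _ hi; simp [oneParam_single_apply, hi.symm]
  · simp

/-- The automorphism of a torus given by an invertible integer matrix. -/
def torusEquiv (A B : Matrix (Fin N) (Fin N) ℤ) (hAB : A * B = 1) (hBA : B * A = 1) :
    Torus N ≃ₜ* Torus N where
  toFun := torusMap A
  invFun := torusMap B
  left_inv t := by rw [← torusMap_mul, hBA, torusMap_one]
  right_inv t := by rw [← torusMap_mul, hAB, torusMap_one]
  map_mul' := map_mul _
  continuous_toFun := continuous_torusMap A
  continuous_invFun := continuous_torusMap B

end TorusMap

/-- Used to reorder a basis so that prescribed members occupy the first positions. -/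
theorem exists_perm_apply_eq {ι α : Type*} [Finite α] (f g : ι ↪ α) :
    ∃ π : Equiv.Perm α, ∀ i, π (f i) = g i := by
  classical
  have := Fintype.ofFinite α
  let e : {x // x ∈ Set.range f} ≃ {x // x ∈ Set.range g} :=
    (Equiv.ofInjective f f.injective).symm.trans (Equiv.ofInjective g g.injective)
  refine ⟨e.extendSubtype, fun i => ?_⟩
  rw [e.extendSubtype_apply_of_mem _ ⟨i, rfl⟩]
  have : (⟨f i, ⟨i, rfl⟩⟩ : {x // x ∈ Set.range f}) = Equiv.ofInjective f f.injective i := rfl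
  rw [Equiv.trans_apply, this, Equiv.symm_apply_apply, Equiv.ofInjective_apply]

theorem exists_matrix_of_basis {N : ℕ} (b : Module.Basis (Fin N) ℤ (Fin N → ℤ)) :
    ∃ B C : Matrix (Fin N) (Fin N) ℤ, B * C = 1 ∧ C * B = 1 ∧
      ∀ x, C.mulVec x = b.equivFun x := by
  refine ⟨LinearMap.toMatrix' b.equivFun.symm.toLinearMap,
    LinearMap.toMatrix' b.equivFun.toLinearMap, ?_, ?_, fun x => ?_⟩
  · rw [← LinearMap.toMatrix'_comp]; simp
  · rw [← LinearMap.toMatrix'_comp]; simp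
  · rw [← Matrix.toLin'_apply, Matrix.toLin'_toMatrix']; rfl

/-! ### The space `M(P, ξ)` -/

section CharSpaceBasics

variable {E : Type*} [NormedAddCommGroup E] [NormedSpace ℝ E] {P : Set E} {N : ℕ}

namespace CharSpace

/-- The class of `(t, p)` in `M(P, ξ)`. -/
def mk (ξ : Facet P → Fin N → ℤ) (u : Torus N × P) : CharSpace ξ := Quotient.mk (charSetoid ξ) u

variable {ξ : Facet P → Fin N → ℤ}

theorem mk_surjective : Function.Surjective (mk ξ) := Quotient.mk_surjective

theorem isQuotientMap_mk : Topology.IsQuotientMap (mk ξ) := isQuotientMap_quot_mk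

theorem continuous_mk : Continuous (mk ξ) := isQuotientMap_mk.continuous

theorem mk_eq_mk_iff {t s : Torus N} {p q : P} :
    mk ξ (t, p) = mk ξ (s, q) ↔ p = q ∧ t⁻¹ * s ∈ isotropy ξ (q : E) := by
  refine Quotient.eq.trans ⟨fun h => ?_, fun h => ?_⟩
  · obtain ⟨h1, h2⟩ := h
    dsimp only at h1 h2
    subst h1
    exact ⟨rfl, h2⟩
  · obtain ⟨rfl, h2⟩ := h
    exact ⟨rfl, h2⟩

theorem smul_mk (g t : Torus N) (p : P) : g • mk ξ (t, p) = mk ξ (g * t, p) := rfl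

/-- The projection `M(P, ξ) → P`. -/
def base (x : CharSpace ξ) : P := 
  Quotient.lift (fun u : Torus N × P => u.2) (fun _ _ (h : (charSetoid ξ).r _ _) => h.1) x

theorem continuous_base : Continuous (base (ξ := ξ)) :=
  isQuotientMap_mk.continuous_iff.2 continuous_snd

theorem base_smul (g : Torus N) (x : CharSpace ξ) : base (g • x) = base x := by
  obtain ⟨⟨t, p⟩, rfl⟩ := mk_surjective x
  rfl

instance [CompactSpace P] : CompactSpace (CharSpace ξ) :=
  inferInstanceAs (CompactSpace (Quotient (charSetoid ξ)))

end CharSpace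

theorem isotropy_eq_bot {ξ : Facet P → Fin N → ℤ} {x : E} (h : ∀ F : Facet P, x ∉ F.1) :
    isotropy ξ x = ⊥ := by
  have : IsEmpty {F : Facet P // x ∈ F.1} := ⟨fun F => h F.1 F.2⟩
  exact iSup_of_empty _

theorem oneParam_mem_isotropy {ξ : Facet P → Fin N → ℤ} {x : E} {F : Facet P} (h : x ∈ F.1)
    (s : Circle) : oneParam (ξ F) s ∈ isotropy ξ x :=
  Subgroup.mem_iSup_of_mem (⟨F, h⟩ : {F : Facet P // x ∈ F.1}) ⟨s, rfl⟩

theorem isotropy_le_iff {ξ : Facet P → Fin N → ℤ} {x : E} {H : Subgroup (Torus N)} :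
    isotropy ξ x ≤ H ↔ ∀ F : Facet P, x ∈ F.1 → ∀ s, oneParam (ξ F) s ∈ H := by
  refine iSup_le_iff.trans ⟨fun h F hF s => h ⟨F, hF⟩ ⟨s, rfl⟩, ?_⟩
  rintro h ⟨F, hF⟩ _ ⟨s, rfl⟩
  exact h F hF s

end CharSpaceBasics

/-! ### Coordinates of `M(P, ξ)` near the fixed tori -/

/-- A facet atlas together with lattice bases adapted to the values of `ξ` at the vertices. -/
structure CharAtlas {E : Type*} [NormedAddCommGroup E] [NormedSpace ℝ E] (n r : ℕ) {P : Set E}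
    (ξ : Facet P → Fin (n + r) → ℤ) extends FacetAtlas n P where
  /-- the matrix whose columns are a basis extending the values of `ξ` at the vertex -/
  frame : P.extremePoints ℝ → Matrix (Fin (n + r)) (Fin (n + r)) ℤ
  /-- the inverse of the matrix `frame` -/
  coframe : P.extremePoints ℝ → Matrix (Fin (n + r)) (Fin (n + r)) ℤ
  frame_mul_coframe : ∀ v, frame v * coframe v = 1
  coframe_mul_frame : ∀ v, coframe v * frame v = 1
  coframe_mulVec : ∀ v i, (coframe v).mulVec (ξ (facet v i)) = Pi.single (Fin.castAdd r i) 1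

theorem FacetAtlas.nonempty_charAtlas {E : Type*} [NormedAddCommGroup E] [NormedSpace ℝ E]
    {n r : ℕ} {P : Set E} (D : FacetAtlas n P) {ξ : Facet P → Fin (n + r) → ℤ}
    (hξ : IsHyperCharacteristic n r ξ) : Nonempty (CharAtlas n r ξ) := by
  have key : ∀ v, ∃ B C : Matrix (Fin (n + r)) (Fin (n + r)) ℤ, B * C = 1 ∧ C * B = 1 ∧
      ∀ i, C.mulVec (ξ (D.facet v i)) = Pi.single (Fin.castAdd r i) 1 := by
    intro v
    obtain ⟨b, e, he⟩ := hξ (D.facet v) (D.facet_injective v)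
      ⟨v.1, Set.mem_iInter.2 fun i => D.mem_facet v i⟩
    obtain ⟨π, hπ⟩ := exists_perm_apply_eq ⟨Fin.castAdd r, Fin.castAdd_injective n r⟩ e
    obtain ⟨B, C, h1, h2, h3⟩ := exists_matrix_of_basis (b.reindex π.symm)
    refine ⟨B, C, h1, h2, fun i => ?_⟩
    have : ξ (D.facet v i) = b.reindex π.symm (Fin.castAdd r i) := by
      rw [← he, ← hπ]; simp
    funext j
    rw [h3, this, Module.Basis.equivFun_self, Pi.single_apply]
    simp only [eq_comm]
  choose B C h1 h2 h3 using key
  exact ⟨{ D with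
    frame := B
    coframe := C
    frame_mul_coframe := h1
    coframe_mul_frame := h2
    coframe_mulVec := h3 }⟩

/-- The argument of a complex number as a point of the circle, with value `1` at `0`. -/
def phase (z : ℂ) : Circle := Circle.exp (Complex.arg z)

theorem phase_mul_norm (z : ℂ) : (phase z : ℂ) * ‖z‖ = z := by
  rw [phase, Circle.coe_exp, mul_comm, Complex.norm_mul_exp_arg_mul_I]

theorem coe_phase {z : ℂ} (hz : z ≠ 0) : (phase z : ℂ) = z / ‖z‖ := by
  have : (‖z‖ : ℂ) ≠ 0 := by simpa using hz
  rw [eq_div_iff this, phase_mul_norm]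

theorem phase_mul_ofReal (u : Circle) {c : ℝ} (hc : 0 < c) : phase ((u : ℂ) * c) = u := by
  have hc' : (c : ℂ) ≠ 0 := by exact_mod_cast hc.ne'
  have h : (u : ℂ) * c ≠ 0 := mul_ne_zero (Circle.coe_ne_zero u) hc'
  apply Subtype.ext
  show (phase _ : ℂ) = u
  rw [coe_phase h, norm_mul, Circle.norm_coe, one_mul, Complex.norm_real, Real.norm_of_nonneg hc.le,
    mul_div_cancel_right₀ _ hc']

/-! ### Complex coordinates over the open star of a vertex. -/

namespace CharAtlas

variable {E : Type*} [NormedAddCommGroup E] [NormedSpace ℝ E] {n r : ℕ} {P : Set E}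
  {ξ : Facet P → Fin (n + r) → ℤ} (A : CharAtlas n r ξ) (v : P.extremePoints ℝ)

theorem frame_mulVec (i : Fin n) :
    (A.frame v).mulVec (Pi.single (Fin.castAdd r i) 1) = ξ (A.facet v i) := by
  rw [← A.coframe_mulVec, Matrix.mulVec_mulVec, A.frame_mul_coframe, Matrix.one_mulVec]

theorem torusMap_frame_coframe (t : Torus (n + r)) :
    torusMap (A.frame v) (torusMap (A.coframe v) t) = t := by
  rw [← torusMap_mul, A.frame_mul_coframe, torusMap_one]

theorem torusMap_coframe_frame (t : Torus (n + r)) :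
    torusMap (A.coframe v) (torusMap (A.frame v) t) = t := by
  rw [← torusMap_mul, A.coframe_mul_frame, torusMap_one]

/-- The moduli of the coordinates of the points over `p`. -/
def modulus (p : E) : Fin (n + r) → ℝ :=
  Fin.addCases (fun i => √(A.d (A.facet v i) p)) (fun _ => 1)

@[simp] theorem modulus_castAdd (p : E) (i : Fin n) :
    A.modulus v p (Fin.castAdd r i) = √(A.d (A.facet v i) p) := by simp [modulus]

@[simp] theorem modulus_natAdd (p : E) (i : Fin r) : A.modulus v p (Fin.natAdd n i) = 1 := by
  simp [modulus]

theorem modulus_nonneg (p : E) (j : Fin (n + r)) : 0 ≤ A.modulus v p j := by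
  refine Fin.addCases (fun i => ?_) (fun i => ?_) j
  · simp [Real.sqrt_nonneg]
  · simp

theorem continuous_modulus (j : Fin (n + r)) : Continuous fun p => A.modulus v p j := by
  refine Fin.addCases (fun i => ?_) (fun i => ?_) j
  · simpa using (A.contDiff_d _).continuous.sqrt
  · simpa using continuous_const

/-- The open star of a vertex. -/
def star : Set P := {p | ∀ F : Facet P, p.1 ∈ F.1 → F ∈ Set.range (A.facet v)}

theorem mem_star_iff (p : P) : p ∈ A.star v ↔ ∀ F ∉ Set.range (A.facet v), 0 < A.d F p := by
  constructor
  · intro h F hF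
    exact lt_of_le_of_ne (A.nonneg_d F p p.2) fun e => hF (h F ((A.d_eq_zero_iff F p p.2).1 e.symm))
  · intro h F hF
    by_contra hcon
    exact (h F hcon).ne' ((A.d_eq_zero_iff F p p.2).2 hF)

theorem isOpen_star [Finite (Facet P)] : IsOpen (A.star v) := by
  have : A.star v = ⋂ F : Facet P, ⋂ _ : F ∉ Set.range (A.facet v), {p : P | 0 < A.d F p} := by
    ext p; simp only [Set.mem_iInter]; exact A.mem_star_iff v p
  rw [this]
  exact isOpen_iInter_of_finite fun F => isOpen_iInter_of_finite fun _ =>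
    isOpen_lt continuous_const ((A.contDiff_d F).continuous.comp continuous_subtype_val)

theorem exists_mem_star (p : P) : ∃ v, p ∈ A.star v := A.exists_vertex p p.2

variable {v}

/-- In the lattice basis at `v`, the isotropy group is the coordinate subtorus of the coordinates
whose modulus vanishes. -/
theorem mem_isotropy_iff {p : P} (hp : p ∈ A.star v) (t : Torus (n + r)) :
    t ∈ isotropy ξ (p : E) ↔ ∀ j, A.modulus v p j ≠ 0 → torusMap (A.coframe v) t j = 1 := by
  constructor
  · intro ht j hj
    have hle : isotropy ξ (p : E) ≤ (Subgroup.pi {j | A.modulus v p j ≠ 0} fun _ => ⊥).comap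
        (torusMap (A.coframe v)) := by
      rw [isotropy_le_iff]
      intro F hF s
      obtain ⟨i, rfl⟩ := hp F hF
      rw [Subgroup.mem_comap, torusMap_oneParam, A.coframe_mulVec, Subgroup.mem_pi]
      intro j hj
      rw [oneParam_single_apply, if_neg]
      · exact one_mem _
      · rintro rfl
        exact hj (by rw [modulus_castAdd, (A.d_eq_zero_iff _ p p.2).2 hF, Real.sqrt_zero])
    exact (Subgroup.mem_pi _).1 (hle ht) j hj
  · intro h
    rw [← A.torusMap_frame_coframe v t, ← prod_oneParam_single (torusMap (A.coframe v) t), map_prod]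
    refine Subgroup.prod_mem _ fun j _ => ?_
    by_cases hj : A.modulus v p j = 0
    · revert hj
      refine Fin.addCases (fun i => ?_) (fun i => ?_) j
      · intro hi
        rw [modulus_castAdd, Real.sqrt_eq_zero (A.nonneg_d _ p p.2),
          A.d_eq_zero_iff _ p p.2] at hi
        rw [torusMap_oneParam, frame_mulVec]
        exact oneParam_mem_isotropy hi _
      · simp
    · rw [h j hj, map_one, map_one]
      exact one_mem _

variable (v)

/-- The coordinates, at the vertex `v`, of the point represented by `u`. -/
def preChart (u : Torus (n + r) × P) : Fin (n + r) → ℂ :=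
  fun j => (torusMap (A.coframe v) u.1 j : ℂ) * A.modulus v u.2 j

theorem continuous_preChart : Continuous (A.preChart v) := by
  refine continuous_pi fun j => ?_
  have h1 : Continuous fun u : Torus (n + r) × P => torusMap (A.coframe v) u.1 j :=
    (continuous_apply j).comp ((continuous_torusMap _).comp continuous_fst)
  have h2 : Continuous fun u : Torus (n + r) × P => A.modulus v u.2 j :=
    (A.continuous_modulus v j).comp (continuous_subtype_val.comp continuous_snd)
  exact (continuous_subtype_val.comp h1).mul (Complex.continuous_ofReal.comp h2)

/-- The coordinates of a point of `M(P, ξ)` at the vertex `v`. -/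
def chart (x : CharSpace ξ) : Fin (n + r) → ℂ := A.preChart v (Quotient.out x)

/-- The domain of the coordinates at the vertex `v`. -/
def chartSource : Set (CharSpace ξ) := CharSpace.base ⁻¹' A.star v

theorem isOpen_chartSource [Finite (Facet P)] : IsOpen (A.chartSource v) :=
  (A.isOpen_star v).preimage CharSpace.continuous_base

variable {v}

/-- Over the star the choice of representative is harmless: two representatives differ by an
isotropy element, which rotates only coordinates equal to zero. -/
theorem chart_mk {t : Torus (n + r)} {p : P} (hp : p ∈ A.star v) :
    A.chart v (CharSpace.mk ξ (t, p)) = A.preChart v (t, p) := by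
  rcases h : Quotient.out (CharSpace.mk ξ (t, p)) with ⟨s, q⟩
  have h1 : CharSpace.mk ξ (s, q) = CharSpace.mk ξ (t, p) := by
    rw [← h]; exact Quotient.out_eq _
  obtain ⟨rfl, h2⟩ := CharSpace.mk_eq_mk_iff.1 h1
  rw [A.mem_isotropy_iff hp] at h2
  rw [chart, h]
  funext j
  by_cases hj : A.modulus v q j = 0
  · simp [preChart, hj]
  · have := h2 j hj
    rw [map_mul, map_inv, Pi.mul_apply, Pi.inv_apply, inv_mul_eq_one] at this
    simp [preChart, this]

theorem continuousOn_chart [Finite (Facet P)] : ContinuousOn (A.chart v) (A.chartSource v) := by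
  rw [CharSpace.isQuotientMap_mk.continuousOn_isOpen_iff (A.isOpen_chartSource v)]
  refine (A.continuous_preChart v).continuousOn.congr ?_
  rintro ⟨t, p⟩ h
  exact A.chart_mk h

theorem chart_smul (t : Torus (n + r)) {x : CharSpace ξ} (hx : x ∈ A.chartSource v) :
    A.chart v (t • x) = stdAct (torusMap (A.coframe v) t) (A.chart v x) := by
  obtain ⟨⟨s, p⟩, rfl⟩ := CharSpace.mk_surjective x
  rw [CharSpace.smul_mk, A.chart_mk (p := p) hx, A.chart_mk (p := p) hx]
  funext j
  simp [preChart, stdAct, mul_assoc]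

theorem smul_mem_chartSource (t : Torus (n + r)) {x : CharSpace ξ} (hx : x ∈ A.chartSource v) :
    t • x ∈ A.chartSource v := by
  rw [chartSource, Set.mem_preimage, CharSpace.base_smul]
  exact hx

variable (v)

/-- The point of the affine hull of `P` below the point with coordinates `z`. -/
def shadow (z : Fin (n + r) → ℂ) : E := A.param v fun i => ‖z (Fin.castAdd r i)‖ ^ 2

/-- The open set of `ℂ^(n+r)` which cuts out the image of the coordinates. -/
def chartRegion : Set (Fin (n + r) → ℂ) :=
  {z | ∀ F ∉ Set.range (A.facet v), 0 < A.d F (A.shadow v z)}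

/-- The image of the coordinates at `v`. -/
def chartTarget : Set (Fin (n + r) → ℂ) := A.chartRegion v ∩ stdModel n r

theorem contDiff_shadow : ContDiff ℝ ∞ (A.shadow v) := by
  refine (A.contDiff_param v).comp (contDiff_pi.2 fun i => ?_)
  exact (contDiff_norm_sq ℝ).comp (contDiff_apply ℝ ℂ (Fin.castAdd r i))

theorem isOpen_chartRegion [Finite (Facet P)] : IsOpen (A.chartRegion v) := by
  have : A.chartRegion v = ⋂ F : Facet P, ⋂ _ : F ∉ Set.range (A.facet v),
      {z | 0 < A.d F (A.shadow v z)} := by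
    ext p; simp [chartRegion]
  rw [this]
  exact isOpen_iInter_of_finite fun F => isOpen_iInter_of_finite fun _ =>
    isOpen_lt continuous_const ((A.contDiff_d F).continuous.comp (A.contDiff_shadow v).continuous)

theorem d_shadow (z : Fin (n + r) → ℂ) (i : Fin n) :
    A.d (A.facet v i) (A.shadow v z) = ‖z (Fin.castAdd r i)‖ ^ 2 := A.d_param v _ i

variable {v}

theorem shadow_mem {z : Fin (n + r) → ℂ} (hz : z ∈ A.chartRegion v) : A.shadow v z ∈ P := by
  refine A.param_mem v _ fun F => ?_
  by_cases hF : F ∈ Set.range (A.facet v)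
  · obtain ⟨i, rfl⟩ := hF
    exact (A.d_shadow v z i).symm ▸ sq_nonneg _
  · exact (hz F hF).le

theorem modulus_shadow {z : Fin (n + r) → ℂ} (hz : z ∈ stdModel n r) (j : Fin (n + r)) :
    A.modulus v (A.shadow v z) j = ‖z j‖ := by
  refine Fin.addCases (fun i => ?_) (fun i => ?_) j
  · rw [modulus_castAdd, d_shadow, Real.sqrt_sq (norm_nonneg _)]
  · rw [modulus_natAdd, hz i]

variable (v)

open Classical in
/-- The inverse of the coordinates at `v`. -/
def chartInv (z : Fin (n + r) → ℂ) : CharSpace ξ :=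
  CharSpace.mk ξ (torusMap (A.frame v) fun j => phase (z j),
    if h : A.shadow v z ∈ P then ⟨_, h⟩ else ⟨v.1, v.2.1⟩)

variable {v}

theorem chartInv_eq {z : Fin (n + r) → ℂ} (hz : z ∈ A.chartRegion v) :
    A.chartInv v z = CharSpace.mk ξ (torusMap (A.frame v) fun j => phase (z j),
      ⟨A.shadow v z, A.shadow_mem hz⟩) := by
  rw [chartInv, dif_pos (A.shadow_mem hz)]

theorem shadow_mem_star {z : Fin (n + r) → ℂ} (hz : z ∈ A.chartRegion v) :
    (⟨A.shadow v z, A.shadow_mem hz⟩ : P) ∈ A.star v := (A.mem_star_iff v _).2 hz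

theorem chartInv_mem {z : Fin (n + r) → ℂ} (hz : z ∈ A.chartRegion v) :
    A.chartInv v z ∈ A.chartSource v := by
  rw [A.chartInv_eq hz]
  exact A.shadow_mem_star hz

theorem base_chartInv {z : Fin (n + r) → ℂ} (hz : z ∈ A.chartRegion v) :
    (CharSpace.base (A.chartInv v z) : E) = A.shadow v z := by
  rw [A.chartInv_eq hz]; rfl

theorem chart_chartInv {z : Fin (n + r) → ℂ} (hz : z ∈ A.chartTarget v) :
    A.chart v (A.chartInv v z) = z := by
  rw [A.chartInv_eq hz.1, A.chart_mk (A.shadow_mem_star hz.1)]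
  funext j
  simp only [preChart, torusMap_coframe_frame, A.modulus_shadow hz.2, phase_mul_norm]

theorem shadow_preChart (t : Torus (n + r)) (p : P) : A.shadow v (A.preChart v (t, p)) = p := by
  have : ∀ i, ‖A.preChart v (t, p) (Fin.castAdd r i)‖ ^ 2 = A.d (A.facet v i) p := fun i => by
    rw [preChart, norm_mul, Circle.norm_coe, one_mul, Complex.norm_real,
      Real.norm_of_nonneg (A.modulus_nonneg v _ _), modulus_castAdd,
      Real.sq_sqrt (A.nonneg_d _ p p.2)]
  simp only [shadow, this]
  exact A.param_d v p p.2

theorem shadow_chart {x : CharSpace ξ} (hx : x ∈ A.chartSource v) :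
    A.shadow v (A.chart v x) = CharSpace.base x := by
  obtain ⟨⟨t, p⟩, rfl⟩ := CharSpace.mk_surjective x
  rw [A.chart_mk (p := p) hx, shadow_preChart]; rfl

theorem chart_mem {x : CharSpace ξ} (hx : x ∈ A.chartSource v) :
    A.chart v x ∈ A.chartTarget v := by
  refine ⟨fun F hF => ?_, fun i => ?_⟩
  · rw [A.shadow_chart hx]
    exact (A.mem_star_iff v _).1 hx F hF
  · obtain ⟨⟨t, p⟩, rfl⟩ := CharSpace.mk_surjective x
    rw [A.chart_mk (p := p) hx]
    rw [preChart, modulus_natAdd, Complex.ofReal_one, mul_one, Circle.norm_coe]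

theorem chartInv_chart {x : CharSpace ξ} (hx : x ∈ A.chartSource v) :
    A.chartInv v (A.chart v x) = x := by
  have h := (A.chart_mem hx).1
  have hs := A.shadow_chart hx
  rw [A.chartInv_eq h]
  obtain ⟨⟨t, p⟩, rfl⟩ := CharSpace.mk_surjective x
  refine CharSpace.mk_eq_mk_iff.2 ⟨Subtype.ext hs, ?_⟩
  rw [A.mem_isotropy_iff (p := p) hx]
  intro j hj
  have hpos := lt_of_le_of_ne (A.modulus_nonneg v p j) hj.symm
  rw [map_mul, map_inv, torusMap_coframe_frame, Pi.mul_apply, Pi.inv_apply, inv_mul_eq_one,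
    A.chart_mk (p := p) hx]
  exact phase_mul_ofReal _ hpos

theorem chart_injOn : Set.InjOn (A.chart v) (A.chartSource v) := fun x hx y hy h => by
  rw [← A.chartInv_chart hx, h, A.chartInv_chart hy]

theorem image_chart : A.chart v '' A.chartSource v = A.chartTarget v := by
  apply Set.Subset.antisymm
  · rintro _ ⟨x, hx, rfl⟩
    exact A.chart_mem hx
  · intro z hz
    exact ⟨_, A.chartInv_mem hz.1, A.chart_chartInv hz⟩

/-- The formula uses the discontinuous function `phase`, so continuity cannot be read off factor by
factor. Compactness of the torus gives limits of the phases along ultrafilters, and injectivity of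
the chart shows that each limit represents the right point. -/
theorem continuousOn_chartInv : ContinuousOn (A.chartInv v) (A.chartTarget v) := by
  intro z hz
  rw [ContinuousWithinAt, Filter.tendsto_iff_ultrafilter]
  intro G hG
  have hGz : (G : Filter (Fin (n + r) → ℂ)) ≤ nhds z := hG.trans nhdsWithin_le_nhds
  have hGt : ∀ᶠ w in (G : Filter (Fin (n + r) → ℂ)), w ∈ A.chartTarget v :=
    hG self_mem_nhdsWithin
  let τ : (Fin (n + r) → ℂ) → Torus (n + r) := fun w => torusMap (A.frame v) fun j => phase (w j)
  classical
  let σ : (Fin (n + r) → ℂ) → P := fun w =>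
    if h : A.shadow v w ∈ P then ⟨_, h⟩ else ⟨v.1, v.2.1⟩
  let p : P := ⟨A.shadow v z, A.shadow_mem hz.1⟩
  have hσ : Filter.Tendsto σ G (nhds p) := by
    rw [tendsto_subtype_rng]
    have h1 : Filter.Tendsto (A.shadow v) G (nhds (A.shadow v z)) :=
      ((A.contDiff_shadow v).continuous.tendsto z).mono_left hGz
    refine h1.congr' ?_
    filter_upwards [hGt] with w hw
    simp only [σ, dif_pos (A.shadow_mem hw.1)]
  obtain ⟨t, -, ht⟩ := isCompact_univ.ultrafilter_le_nhds (G.map τ) (by simp)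
  have hτ : Filter.Tendsto τ G (nhds t) := ht
  have hpair : Filter.Tendsto (fun w => (τ w, σ w)) G (nhds (t, p)) := hτ.prodMk_nhds hσ
  have hlim : Filter.Tendsto (A.chartInv v) G (nhds (CharSpace.mk ξ (t, p))) :=
    (CharSpace.continuous_mk.tendsto _).comp hpair
  have h2 : Filter.Tendsto (fun w => A.preChart v (τ w, σ w)) G (nhds (A.preChart v (t, p))) :=
    ((A.continuous_preChart v).tendsto _).comp hpair
  have h3 : Filter.Tendsto (fun w => A.preChart v (τ w, σ w)) G (nhds z) := by
    refine Filter.Tendsto.congr' ?_ (show Filter.Tendsto id G (nhds z) from hGz)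
    filter_upwards [hGt] with w hw
    have h4 : σ w = ⟨A.shadow v w, A.shadow_mem hw.1⟩ := dif_pos _
    have h5 := A.chart_chartInv hw
    rw [A.chartInv_eq hw.1, A.chart_mk (A.shadow_mem_star hw.1)] at h5
    rw [h4]
    exact h5.symm
  have h6 : A.preChart v (t, p) = z := tendsto_nhds_unique h2 h3
  have h7 : CharSpace.mk ξ (t, p) = A.chartInv v z := by
    have hp : p ∈ A.star v := A.shadow_mem_star hz.1
    apply A.chart_injOn (v := v) hp (A.chartInv_mem hz.1)
    rw [A.chart_chartInv hz, A.chart_mk hp, h6]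
  rwa [h7] at hlim

/-- Points over different points of `P` are separated by the projection, points over the same one by
a chart. -/
theorem t2Space (A : CharAtlas n r ξ) [Finite (Facet P)] : T2Space (CharSpace ξ) := by
  refine ⟨fun x y hxy => ?_⟩
  by_cases h : CharSpace.base x = CharSpace.base y
  · obtain ⟨v, hv⟩ := A.exists_mem_star (CharSpace.base x)
    have hx : x ∈ A.chartSource v := hv
    have hy : y ∈ A.chartSource v := by rw [chartSource, Set.mem_preimage, ← h]; exact hv
    have hne : A.chart v x ≠ A.chart v y := fun e => hxy (A.chart_injOn hx hy e)
    obtain ⟨U, W, hU, hW, hxU, hyW, hUW⟩ := t2_separation hne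
    exact ⟨_, _, A.continuousOn_chart.isOpen_inter_preimage (A.isOpen_chartSource v) hU,
      A.continuousOn_chart.isOpen_inter_preimage (A.isOpen_chartSource v) hW, ⟨hx, hxU⟩, ⟨hy, hyW⟩,
      Set.disjoint_left.2 fun w h1 h2 => Set.disjoint_left.1 hUW h1.2 h2.2⟩
  · obtain ⟨U, W, hU, hW, hxU, hyW, hUW⟩ := t2_separation h
    exact ⟨_, _, hU.preimage CharSpace.continuous_base, hW.preimage CharSpace.continuous_base,
      hxU, hyW, hUW.preimage _⟩

/-- Over a point in no facet the isotropy group is trivial. -/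
theorem faithfulSMul (A : CharAtlas n r ξ) : FaithfulSMul (Torus (n + r)) (CharSpace ξ) := by
  obtain ⟨p, hp, h⟩ := A.exists_interior
  refine ⟨fun {s t} hst => ?_⟩
  have h1 := hst (CharSpace.mk ξ (1, ⟨p, hp⟩))
  rw [CharSpace.smul_mk, CharSpace.smul_mk, CharSpace.mk_eq_mk_iff, isotropy_eq_bot h,
    Subgroup.mem_bot, mul_one, mul_one, inv_mul_eq_one] at h1
  exact h1.2

end CharAtlas

/-! ### The smooth structure of `M(P, ξ)` -/

section StdAct

variable {N : ℕ}

theorem stdAct_apply (t : Torus N) (z : Fin N → ℂ) (j : Fin N) : stdAct t z j = (t j : ℂ) * z j := rfl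

theorem stdAct_inv_stdAct (t : Torus N) (z : Fin N → ℂ) : stdAct t⁻¹ (stdAct t z) = z := by
  funext j
  rw [stdAct_apply, stdAct_apply, Pi.inv_apply, ← mul_assoc, ← Circle.coe_mul, inv_mul_cancel,
    Circle.coe_one, one_mul]

theorem stdAct_stdAct_inv (t : Torus N) (z : Fin N → ℂ) : stdAct t (stdAct t⁻¹ z) = z := by
  simpa using stdAct_inv_stdAct t⁻¹ z

theorem norm_stdAct (t : Torus N) (z : Fin N → ℂ) (j : Fin N) : ‖stdAct t z j‖ = ‖z j‖ := by
  rw [stdAct_apply, norm_mul, Circle.norm_coe, one_mul]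

theorem contDiff_stdAct (t : Torus N) : ContDiff ℝ ∞ (stdAct t) :=
  contDiff_pi.2 fun j => contDiff_const.mul (contDiff_apply ℝ ℂ j)

theorem stdAct_mem_stdModel {n r : ℕ} (t : Torus (n + r)) {z : Fin (n + r) → ℂ}
    (hz : z ∈ stdModel n r) : stdAct t z ∈ stdModel n r := fun j => by
  rw [norm_stdAct, hz j]

end StdAct

/-! ### Real coordinates on the model `ℂ^n × T^r`. -/

section ModelCoordinates

variable (n r : ℕ)

/-- The splitting of the real coordinates of `ℂ^n × T^r` into real parts, imaginary parts, and
angles. -/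
def modelIndex : (Fin n ⊕ Fin n) ⊕ Fin r ≃ Fin (2 * n + r) :=
  ((Equiv.sumCongr finSumFinEquiv (Equiv.refl _)).trans finSumFinEquiv).trans
    (finCongr (by omega))

/-- The points of `ℂ^(n+r)` whose last `r` coordinates lie in the slit plane. -/
def modelSlit : Set (Fin (n + r) → ℂ) := {z | ∀ j, z (Fin.natAdd n j) ∈ Complex.slitPlane}

/-- The points of real coordinate space with angles in `(-π, π)`. -/
def angleBox : Set (EuclideanSpace ℝ (Fin (2 * n + r))) :=
  {y | ∀ j, y (modelIndex n r (Sum.inr j)) ∈ Set.Ioo (-Real.pi) Real.pi}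

variable {n r}

/-- The exponential parametrization of `ℂ^n × T^r`. -/
def toModel (y : EuclideanSpace ℝ (Fin (2 * n + r))) : Fin (n + r) → ℂ :=
  Fin.addCases
    (fun i => (y (modelIndex n r (Sum.inl (Sum.inl i))) : ℂ) +
      y (modelIndex n r (Sum.inl (Sum.inr i))) * Complex.I)
    (fun j => Complex.exp (y (modelIndex n r (Sum.inr j)) * Complex.I))

/-- The logarithmic coordinates of `ℂ^n × T^r`. -/
def ofModel (z : Fin (n + r) → ℂ) : EuclideanSpace ℝ (Fin (2 * n + r)) :=
  WithLp.toLp 2 fun k => Sum.elim (Sum.elim (fun i => (z (Fin.castAdd r i)).re)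
    (fun i => (z (Fin.castAdd r i)).im)) (fun j => (z (Fin.natAdd n j)).arg)
    ((modelIndex n r).symm k)

theorem isOpen_modelSlit : IsOpen (modelSlit n r) := by
  have : modelSlit n r = ⋂ j : Fin r, (fun z => z (Fin.natAdd n j)) ⁻¹' Complex.slitPlane := by
    ext; simp [modelSlit]
  rw [this]
  exact isOpen_iInter_of_finite fun j => Complex.isOpen_slitPlane.preimage (continuous_apply _)

theorem continuous_coord (k : Fin (2 * n + r)) :
    Continuous fun y : EuclideanSpace ℝ (Fin (2 * n + r)) => y k :=
  (contDiff_euclidean (n := 0).1 contDiff_id k).continuous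

theorem isOpen_angleBox : IsOpen (angleBox n r) := by
  have : angleBox n r = ⋂ j : Fin r,
      (fun y : EuclideanSpace ℝ (Fin (2 * n + r)) => y (modelIndex n r (Sum.inr j))) ⁻¹'
        Set.Ioo (-Real.pi) Real.pi := by
    ext; simp [angleBox]
  rw [this]
  exact isOpen_iInter_of_finite fun j => isOpen_Ioo.preimage (continuous_coord _)

theorem toModel_mem (y : EuclideanSpace ℝ (Fin (2 * n + r))) : toModel y ∈ stdModel n r := by
  intro j
  simp [toModel, Complex.norm_exp_ofReal_mul_I]

theorem toModel_mem_modelSlit {y : EuclideanSpace ℝ (Fin (2 * n + r))} (hy : y ∈ angleBox n r) :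
    toModel y ∈ modelSlit n r := by
  intro j
  have := hy j
  simp only [toModel, Fin.addCases_right]
  rw [Complex.mem_slitPlane_iff_arg]
  refine ⟨?_, Complex.exp_ne_zero _⟩
  rw [Complex.arg_exp_mul_I, (toIocMod_eq_self Real.two_pi_pos).2 ⟨this.1, by linarith [this.2]⟩]
  exact this.2.ne

theorem ofModel_mem_angleBox {z : Fin (n + r) → ℂ} (hz : z ∈ modelSlit n r) :
    ofModel z ∈ angleBox n r := by
  intro j
  simp only [ofModel, Equiv.symm_apply_apply, Sum.elim_inr]
  exact ⟨Complex.neg_pi_lt_arg _,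
    lt_of_le_of_ne (Complex.arg_le_pi _) (Complex.mem_slitPlane_iff_arg.1 (hz j)).1⟩

theorem toModel_ofModel {z : Fin (n + r) → ℂ} (hz : z ∈ stdModel n r) : toModel (ofModel z) = z := by
  funext j
  refine Fin.addCases (fun i => ?_) (fun i => ?_) j
  · simp [toModel, ofModel, Complex.re_add_im]
  · simp only [toModel, ofModel, Fin.addCases_right, Equiv.symm_apply_apply, Sum.elim_inr]
    have := Complex.norm_mul_exp_arg_mul_I (z (Fin.natAdd n i))
    rwa [hz i, Complex.ofReal_one, one_mul] at this

theorem ofModel_toModel {y : EuclideanSpace ℝ (Fin (2 * n + r))} (hy : y ∈ angleBox n r) :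
    ofModel (toModel y) = y := by
  ext k
  obtain ⟨s, rfl⟩ := (modelIndex n r).surjective k
  rcases s with (i | i) | j
  · simp [toModel, ofModel]
  · simp [toModel, ofModel]
  · have := hy j
    simp only [toModel, ofModel, Equiv.symm_apply_apply, Sum.elim_inr, Fin.addCases_right]
    rw [Complex.arg_exp_mul_I, (toIocMod_eq_self Real.two_pi_pos).2 ⟨this.1, by linarith [this.2]⟩]

theorem contDiff_toModel : ContDiff ℝ ∞ (toModel (n := n) (r := r)) := by
  have hc : ∀ k, ContDiff ℝ ∞ fun y : EuclideanSpace ℝ (Fin (2 * n + r)) => (y k : ℂ) := fun k =>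
    Complex.ofRealCLM.contDiff.comp (contDiff_euclidean.1 contDiff_id k)
  refine contDiff_pi.2 fun j => ?_
  refine Fin.addCases (fun i => ?_) (fun i => ?_) j
  · simp only [toModel, Fin.addCases_left]
    exact (hc _).add ((hc _).mul contDiff_const)
  · simp only [toModel, Fin.addCases_right]
    exact ((hc _).mul contDiff_const).cexp

theorem contDiffAt_arg {z : ℂ} (hz : z ∈ Complex.slitPlane) : ContDiffAt ℝ ∞ Complex.arg z := by
  have h : ContDiffAt ℝ ∞ Complex.log z := (Complex.contDiffAt_log hz).restrict_scalars ℝ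
  have := Complex.imCLM.contDiff.contDiffAt.comp z h
  refine this.congr_of_eventuallyEq (Filter.Eventually.of_forall fun w => ?_)
  simp [Complex.log_im]

theorem contDiffAt_ofModel {z : Fin (n + r) → ℂ} (hz : z ∈ modelSlit n r) :
    ContDiffAt ℝ ∞ ofModel z := by
  rw [contDiffAt_euclidean]
  intro k
  obtain ⟨s, rfl⟩ := (modelIndex n r).surjective k
  rcases s with (i | i) | j
  · simp only [ofModel, Equiv.symm_apply_apply, Sum.elim_inl]
    exact Complex.reCLM.contDiff.contDiffAt.comp z (contDiff_apply ℝ ℂ _).contDiffAt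
  · simp only [ofModel, Equiv.symm_apply_apply, Sum.elim_inl, Sum.elim_inr]
    exact Complex.imCLM.contDiff.contDiffAt.comp z (contDiff_apply ℝ ℂ _).contDiffAt
  · simp only [ofModel, Equiv.symm_apply_apply, Sum.elim_inr]
    exact ContDiffAt.comp z (contDiffAt_arg (hz j)) (contDiff_apply ℝ ℂ _).contDiffAt

end ModelCoordinates

theorem contDiffAt_zpow_complex {X : Type*} [NormedAddCommGroup X] [NormedSpace ℝ X] {f : X → ℂ}
    {x : X} (hf : ContDiffAt ℝ ∞ f x) (hx : f x ≠ 0) (m : ℤ) :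
    ContDiffAt ℝ ∞ (fun y => f y ^ m) x := by
  cases m with
  | ofNat k => simpa using hf.pow k
  | negSucc k =>
    simp only [zpow_negSucc]
    exact (hf.pow _).inv (pow_ne_zero _ hx)

/-! ### Smooth transition maps and the resulting atlas. -/

namespace CharAtlas

variable {E : Type*} [NormedAddCommGroup E] [NormedSpace ℝ E] {n r : ℕ} {P : Set E}
  {ξ : Facet P → Fin (n + r) → ℤ} (A : CharAtlas n r ξ) (v w : P.extremePoints ℝ)

/-- The part of the coordinate domain at `v` which lies in the coordinate domain at `w`. -/
def overlap : Set (Fin (n + r) → ℂ) :=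
  {z | z ∈ A.chartTarget v ∧ ∀ F ∉ Set.range (A.facet w), 0 < A.d F (A.shadow v z)}

theorem mem_overlap {z : Fin (n + r) → ℂ} (hz : z ∈ A.chartTarget v)
    (h : A.chartInv v z ∈ A.chartSource w) : z ∈ A.overlap v w := by
  refine ⟨hz, ?_⟩
  rw [← A.base_chartInv hz.1]
  exact (A.mem_star_iff w _).1 h

/-- The coordinates at `v` whose facets also contain `w`. -/
def IsShared (j : Fin (n + r)) : Prop :=
  ∃ i i', j = Fin.castAdd r i ∧ A.facet v i = A.facet w i'

variable {v w}

theorem ne_zero_of_not_isShared {z : Fin (n + r) → ℂ} (hz : z ∈ A.overlap v w) {j : Fin (n + r)}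
    (hj : ¬ A.IsShared v w j) : z j ≠ 0 := by
  revert hj
  refine Fin.addCases (fun i => ?_) (fun i => ?_) j
  · intro hj h0
    have := hz.2 (A.facet v i) (by
      rintro ⟨i', hi'⟩
      exact hj ⟨i, i', rfl, hi'.symm⟩)
    rw [A.d_shadow, h0] at this
    simp at this
  · intro _ h0
    have := hz.1.2 i
    rw [h0] at this
    simp at this

/-- A facet through both vertices has the same vector in either frame, so its column of the
transition matrix is a unit vector. -/
theorem transition_apply {i i' : Fin n} (h : A.facet v i = A.facet w i') (k : Fin (n + r)) :
    (A.coframe w * A.frame v) k (Fin.castAdd r i) = if k = Fin.castAdd r i' then 1 else 0 := by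
  have h1 : (A.coframe w * A.frame v).mulVec (Pi.single (Fin.castAdd r i) 1) =
      Pi.single (Fin.castAdd r i') 1 := by
    rw [← Matrix.mulVec_mulVec, A.frame_mulVec, h, A.coframe_mulVec]
  have h2 := congrFun h1 k
  rwa [Matrix.mulVec_single_one, Pi.single_apply] at h2

theorem chart_chartInv_apply {z : Fin (n + r) → ℂ} (hz : z ∈ A.overlap v w) (k : Fin (n + r)) :
    A.chart w (A.chartInv v z) k =
      (∏ j, (phase (z j) : ℂ) ^ (A.coframe w * A.frame v) k j) * A.modulus w (A.shadow v z) k := by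
  rw [A.chartInv_eq hz.1.1, A.chart_mk (show _ ∈ A.star w from (A.mem_star_iff w _).2 hz.2), preChart]
  congr 1
  rw [← torusMap_mul, torusMap_apply]
  refine (map_prod Circle.coeHom _ _).trans (Finset.prod_congr rfl fun j _ => ?_)
  exact map_zpow Circle.coeHom _ _

/-- Phases and square roots are singular only where a coordinate or a defining function vanishes. On
the overlap this happens only for shared facets, and there phase and modulus recombine into the
coordinate itself. -/
theorem contDiffWithinAt_transition {z₀ : Fin (n + r) → ℂ} (hz₀ : z₀ ∈ A.overlap v w) :
    ContDiffWithinAt ℝ ∞ (fun z => A.chart w (A.chartInv v z)) (A.overlap v w) z₀ := by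
  classical
  rw [contDiffWithinAt_pi]
  intro k
  set M := A.coframe w * A.frame v with hM
  set S : Finset (Fin (n + r)) := Finset.univ.filter (A.IsShared v w) with hS
  have hsplit : ∀ z ∈ A.overlap v w, A.chart w (A.chartInv v z) k =
      (∏ j ∈ Sᶜ, (z j / ‖z j‖) ^ M k j) *
        ((∏ j ∈ S, (phase (z j) : ℂ) ^ M k j) * A.modulus w (A.shadow v z) k) := by
    intro z hz
    rw [A.chart_chartInv_apply hz, ← Finset.prod_compl_mul_prod S, mul_assoc]
    congr 1
    refine Finset.prod_congr rfl fun j hj => ?_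
    rw [coe_phase (A.ne_zero_of_not_isShared hz (by simpa [hS] using hj))]
  have hsmooth : ContDiffAt ℝ ∞
      (fun z : Fin (n + r) → ℂ => ∏ j ∈ Sᶜ, (z j / ‖z j‖) ^ M k j) z₀ := by
    refine contDiffAt_prod fun j hj => ?_
    have h0 : z₀ j ≠ 0 := A.ne_zero_of_not_isShared hz₀ (by simpa [hS] using hj)
    have h1 : ContDiffAt ℝ ∞ (fun z : Fin (n + r) → ℂ => z j) z₀ :=
      (contDiff_apply ℝ ℂ j).contDiffAt
    have h2 : ContDiffAt ℝ ∞ (fun z : Fin (n + r) → ℂ => ((‖z j‖ : ℝ) : ℂ)) z₀ :=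
      Complex.ofRealCLM.contDiff.contDiffAt.comp z₀ (h1.norm ℝ h0)
    have h3 : ((‖z₀ j‖ : ℝ) : ℂ) ≠ 0 := by simpa using h0
    refine contDiffAt_zpow_complex (f := fun z : Fin (n + r) → ℂ => z j / ‖z j‖) ?_ (div_ne_zero h0 h3) _
    simp only [div_eq_mul_inv]
    exact h1.mul (h2.inv h3)
  by_cases hk : ∃ i i', k = Fin.castAdd r i' ∧ A.facet v i = A.facet w i'
  · obtain ⟨i, i', rfl, hi⟩ := hk
    -- Among the shared coordinates only the one of the same facet enters row `i'`, with exponent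
    -- `1`; its phase times its modulus is the coordinate.
    have hrest : ∀ z ∈ A.overlap v w, (∏ j ∈ S, (phase (z j) : ℂ) ^ M (Fin.castAdd r i') j) *
        A.modulus w (A.shadow v z) (Fin.castAdd r i') = z (Fin.castAdd r i) := by
      intro z hz
      rw [Finset.prod_eq_single (Fin.castAdd r i)]
      · rw [hM, A.transition_apply hi, if_pos rfl, zpow_one, A.modulus_castAdd, ← hi, A.d_shadow,
          Real.sqrt_sq (norm_nonneg _), phase_mul_norm]
      · intro j hj hne
        obtain ⟨i₁, i₁', rfl, h1⟩ := (Finset.mem_filter.1 hj).2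
        rw [hM, A.transition_apply h1, if_neg, zpow_zero]
        intro e
        have e' : i' = i₁' := Fin.castAdd_injective n r e
        rw [← e', ← hi] at h1
        exact hne (congrArg _ (A.facet_injective v h1))
      · intro hn
        exact absurd (Finset.mem_filter.2 ⟨Finset.mem_univ _, i, i', rfl, hi⟩) hn
    refine (hsmooth.mul (contDiff_apply ℝ ℂ (Fin.castAdd r i)).contDiffAt).contDiffWithinAt.congr
      (fun z hz => ?_) ?_
    · rw [hsplit z hz, hrest z hz]
    · rw [hsplit z₀ hz₀, hrest z₀ hz₀]
  · have hrest : ∀ z : Fin (n + r) → ℂ, (∏ j ∈ S, (phase (z j) : ℂ) ^ M k j) = 1 := by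
      intro z
      refine Finset.prod_eq_one fun j hj => ?_
      obtain ⟨i₁, i₁', rfl, h1⟩ := (Finset.mem_filter.1 hj).2
      rw [hM, A.transition_apply h1, if_neg, zpow_zero]
      rintro rfl
      exact hk ⟨i₁, i₁', rfl, h1⟩
    -- A facet at `w` that is not at `v` has positive defining function on the chart region of `v`,
    -- so the square root is smooth.
    have hmod : ContDiffAt ℝ ∞ (fun z => A.modulus w (A.shadow v z) k) z₀ := by
      revert hk
      refine Fin.addCases (fun i' => ?_) (fun i' => ?_) k
      · intro hk
        simp only [modulus_castAdd]
        refine ContDiffAt.sqrt ((A.contDiff_d _).comp (A.contDiff_shadow v)).contDiffAt ?_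
        refine (hz₀.1.1 _ ?_).ne'
        rintro ⟨i, hi⟩
        exact hk ⟨i, i', rfl, hi⟩
      · intro _
        simpa only [modulus_natAdd] using contDiffAt_const
    have hmod' := Complex.ofRealCLM.contDiff.contDiffAt.comp z₀ hmod
    refine (hsmooth.mul hmod').contDiffWithinAt.congr (fun z hz => ?_) ?_
    · rw [hsplit z hz, hrest z, one_mul]; rfl
    · rw [hsplit z₀ hz₀, hrest z₀, one_mul]; rfl

variable (v)

theorem stdAct_toModel_mem (τ : Torus (n + r)) {y : EuclideanSpace ℝ (Fin (2 * n + r))}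
    (hy : stdAct τ (toModel y) ∈ A.chartRegion v) : stdAct τ (toModel y) ∈ A.chartTarget v :=
  ⟨hy, stdAct_mem_stdModel τ (toModel_mem y)⟩

/-- A vertex whose open star contains the image of a given point. -/
def vertexAt (x : CharSpace ξ) : P.extremePoints ℝ := (A.exists_mem_star (CharSpace.base x)).choose

theorem mem_chartSource_vertexAt (x : CharSpace ξ) : x ∈ A.chartSource (A.vertexAt x) :=
  (A.exists_mem_star (CharSpace.base x)).choose_spec

variable [Finite (Facet P)]

/-- A Euclidean chart of `M(P, ξ)`. -/
def euclideanChart (τ : Torus (n + r)) :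
    OpenPartialHomeomorph (CharSpace ξ) (EuclideanSpace ℝ (Fin (2 * n + r))) where
  toFun x := ofModel (stdAct τ⁻¹ (A.chart v x))
  invFun y := A.chartInv v (stdAct τ (toModel y))
  source := A.chartSource v ∩ A.chart v ⁻¹' (stdAct τ⁻¹ ⁻¹' modelSlit n r)
  target := angleBox n r ∩ {y | stdAct τ (toModel y) ∈ A.chartRegion v}
  map_source' x hx := by
    have h := A.chart_mem hx.1
    refine ⟨ofModel_mem_angleBox hx.2, ?_⟩
    rw [Set.mem_ofPred_eq, toModel_ofModel (stdAct_mem_stdModel _ h.2), stdAct_stdAct_inv]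
    exact h.1
  map_target' y hy := by
    refine ⟨A.chartInv_mem hy.2, ?_⟩
    rw [Set.mem_preimage, A.chart_chartInv (A.stdAct_toModel_mem v τ hy.2), Set.mem_preimage,
      stdAct_inv_stdAct]
    exact toModel_mem_modelSlit hy.1
  left_inv' x hx := by
    have h := A.chart_mem hx.1
    rw [toModel_ofModel (stdAct_mem_stdModel _ h.2), stdAct_stdAct_inv, A.chartInv_chart hx.1]
  right_inv' y hy := by
    rw [A.chart_chartInv (A.stdAct_toModel_mem v τ hy.2), stdAct_inv_stdAct,
      ofModel_toModel hy.1]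
  continuousOn_toFun := by
    intro x hx
    have h1 : ContinuousWithinAt (A.chart v) (A.chartSource v ∩ A.chart v ⁻¹'
        (stdAct τ⁻¹ ⁻¹' modelSlit n r)) x := (A.continuousOn_chart x hx.1).mono Set.inter_subset_left
    have h2 : ContinuousAt (fun z => ofModel (stdAct τ⁻¹ z)) (A.chart v x) :=
      ContinuousAt.comp (f := stdAct τ⁻¹) (contDiffAt_ofModel hx.2).continuousAt
        (contDiff_stdAct τ⁻¹).continuous.continuousAt
    exact h2.comp_continuousWithinAt h1
  continuousOn_invFun := by
    refine A.continuousOn_chartInv.comp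
      ((contDiff_stdAct τ).continuous.comp contDiff_toModel.continuous).continuousOn ?_
    intro y hy
    exact A.stdAct_toModel_mem v τ hy.2
  open_source := A.continuousOn_chart.isOpen_inter_preimage (A.isOpen_chartSource v)
    (isOpen_modelSlit.preimage (contDiff_stdAct τ⁻¹).continuous)
  open_target := isOpen_angleBox.inter ((A.isOpen_chartRegion v).preimage
    ((contDiff_stdAct τ).continuous.comp contDiff_toModel.continuous))

variable {v}

/-- Rotating by the phases of `x` itself moves its circle coordinates to `1`, away from the cut of
the argument. -/
theorem mem_euclideanChart_source {x : CharSpace ξ} (hx : x ∈ A.chartSource v) :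
    x ∈ (A.euclideanChart v fun j => phase (A.chart v x j)).source := by
  refine ⟨hx, fun j => ?_⟩
  have h1 := phase_mul_norm (A.chart v x (Fin.natAdd n j))
  rw [(A.chart_mem hx).2 j, Complex.ofReal_one, mul_one] at h1
  rw [stdAct_apply, Pi.inv_apply]
  nth_rw 2 [← h1]
  rw [← Circle.coe_mul, inv_mul_cancel, Circle.coe_one]
  exact Complex.one_mem_slitPlane

/-- The atlas of `M(P, ξ)` given by the Euclidean charts. -/
@[reducible] def chartedSpace :
    ChartedSpace (EuclideanSpace ℝ (Fin (2 * n + r))) (CharSpace ξ) where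
  atlas := {e | ∃ v τ, e = A.euclideanChart v τ}
  chartAt x := A.euclideanChart (A.vertexAt x) fun j => phase (A.chart (A.vertexAt x) x j)
  mem_chart_source x := A.mem_euclideanChart_source (A.mem_chartSource_vertexAt x)
  chart_mem_atlas _ := ⟨_, _, rfl⟩

theorem isManifold :
    @IsManifold ℝ _ _ _ _ _ _ (𝓡 (2 * n + r)) ∞ (CharSpace ξ) _ A.chartedSpace := by
  let _ := A.chartedSpace
  refine isManifold_of_contDiffOn _ _ _ ?_
  rintro _ _ ⟨v, τ, rfl⟩ ⟨w, ρ, rfl⟩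
  rintro y ⟨⟨hy1, hy2⟩, -⟩
  set e := A.euclideanChart v τ
  set e' := A.euclideanChart w ρ
  have hz : stdAct τ (toModel y) ∈ A.overlap v w :=
    A.mem_overlap v w (A.stdAct_toModel_mem v τ hy1.2) hy2.1
  have h1 : ContDiffAt ℝ ∞ (fun y => stdAct τ (toModel y)) y :=
    ((contDiff_stdAct τ).comp contDiff_toModel).contDiffAt
  have h2 : ContDiffWithinAt ℝ ∞ (fun y => A.chart w (A.chartInv v (stdAct τ (toModel y))))
      ((e.symm ≫ₕ e').source) y := by
    refine ContDiffWithinAt.comp (g := fun z => A.chart w (A.chartInv v z))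
      (f := fun y => stdAct τ (toModel y)) y (A.contDiffWithinAt_transition hz) h1.contDiffWithinAt ?_
    rintro y' ⟨h3, h4⟩
    exact A.mem_overlap v w (A.stdAct_toModel_mem v τ h3.2) h4.1
  have h3 : ContDiffAt ℝ ∞ (fun z => ofModel (stdAct ρ⁻¹ z))
      (A.chart w (A.chartInv v (stdAct τ (toModel y)))) :=
    ContDiffAt.comp (f := stdAct ρ⁻¹) _ (contDiffAt_ofModel hy2.2) (contDiff_stdAct ρ⁻¹).contDiffAt
  have h4 := h3.comp_contDiffWithinAt y h2
  refine ContDiffWithinAt.mono h4 ?_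
  rintro y' ⟨h5, -⟩
  exact h5

theorem contMDiffOn_chart (v : P.extremePoints ℝ) :
    @ContMDiffOn ℝ _ _ _ _ _ _ (𝓡 (2 * n + r)) (CharSpace ξ) _ A.chartedSpace _ _ _ _ _
      𝓘(ℝ, Fin (n + r) → ℂ) (Fin (n + r) → ℂ) _ _ ∞ (A.chart v) (A.chartSource v) := by
  let _ := A.chartedSpace
  have := A.isManifold
  intro x hx
  set τ : Torus (n + r) := fun j => phase (A.chart v x j)
  set e := A.euclideanChart v τ
  have hxe : x ∈ e.source := A.mem_euclideanChart_source hx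
  have he : e ∈ IsManifold.maximalAtlas (𝓡 (2 * n + r)) ∞ (CharSpace ξ) :=
    StructureGroupoid.subset_maximalAtlas _ ⟨v, τ, rfl⟩
  have h1 : ContMDiffAt (𝓡 (2 * n + r)) (𝓡 (2 * n + r)) ∞ e x :=
    (contMDiffOn_of_mem_maximalAtlas he).contMDiffAt (e.open_source.mem_nhds hxe)
  have h2 : ContMDiff (𝓡 (2 * n + r)) 𝓘(ℝ, Fin (n + r) → ℂ) ∞
      (fun y : EuclideanSpace ℝ (Fin (2 * n + r)) => stdAct τ (toModel y)) :=
    ((contDiff_stdAct τ).comp contDiff_toModel).contMDiff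
  have h3 := (h2.contMDiffAt (x := e x)).comp x h1
  refine (h3.congr_of_eventuallyEq ?_).contMDiffWithinAt
  filter_upwards [e.open_source.mem_nhds hxe] with x' hx'
  have h := A.chart_mem hx'.1
  show _ = stdAct τ (toModel (ofModel (stdAct τ⁻¹ (A.chart v x'))))
  rw [toModel_ofModel (stdAct_mem_stdModel _ h.2), stdAct_stdAct_inv]

theorem contMDiffOn_chartInv (v : P.extremePoints ℝ) :
    @ContMDiffOn ℝ _ _ _ _ _ _ 𝓘(ℝ, Fin (n + r) → ℂ) (Fin (n + r) → ℂ) _ _ _ _ _ _ _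
      (𝓡 (2 * n + r)) (CharSpace ξ) _ A.chartedSpace ∞ (A.chartInv v) (A.chartTarget v) := by
  let _ := A.chartedSpace
  have := A.isManifold
  intro z hz
  set x := A.chartInv v z
  have hx : x ∈ A.chartSource v := A.chartInv_mem hz.1
  set τ : Torus (n + r) := fun j => phase (A.chart v x j)
  set e := A.euclideanChart v τ
  have hxe : x ∈ e.source := A.mem_euclideanChart_source hx
  have hzx : A.chart v x = z := A.chart_chartInv hz
  have hslit : stdAct τ⁻¹ z ∈ modelSlit n r := by
    have := hxe.2
    rwa [Set.mem_preimage, hzx] at this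
  have he : e ∈ IsManifold.maximalAtlas (𝓡 (2 * n + r)) ∞ (CharSpace ξ) :=
    StructureGroupoid.subset_maximalAtlas _ ⟨v, τ, rfl⟩
  have hy : ofModel (stdAct τ⁻¹ z) ∈ e.target := by
    have := e.map_source hxe
    rwa [show e x = ofModel (stdAct τ⁻¹ (A.chart v x)) from rfl, hzx] at this
  have h1 : ContMDiffAt (𝓡 (2 * n + r)) (𝓡 (2 * n + r)) ∞ e.symm (ofModel (stdAct τ⁻¹ z)) :=
    (contMDiffOn_symm_of_mem_maximalAtlas he).contMDiffAt (e.open_target.mem_nhds hy)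
  have h2 : ContMDiffAt 𝓘(ℝ, Fin (n + r) → ℂ) (𝓡 (2 * n + r)) ∞
      (fun z : Fin (n + r) → ℂ => ofModel (stdAct τ⁻¹ z)) z :=
    (ContDiffAt.comp (f := stdAct τ⁻¹) z (contDiffAt_ofModel hslit)
      (contDiff_stdAct τ⁻¹).contDiffAt).contMDiffAt
  have h3 := (ContMDiffAt.comp z h1 h2).contMDiffWithinAt (s := A.chartTarget v)
  have key : ∀ z' ∈ A.chartTarget v,
      A.chartInv v z' = (e.symm ∘ fun z => ofModel (stdAct τ⁻¹ z)) z' := by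
    intro z' hz'
    show _ = A.chartInv v (stdAct τ (toModel (ofModel (stdAct τ⁻¹ z'))))
    rw [toModel_ofModel (stdAct_mem_stdModel _ hz'.2), stdAct_stdAct_inv]
  exact h3.congr key (key z hz)

theorem admitsLocallyStandardStructure (A : CharAtlas n r ξ) [CompactSpace P] :
    AdmitsLocallyStandardStructure n r (CharSpace ξ) := by
  let _ := A.chartedSpace
  refine ⟨A.chartedSpace, A.t2Space, ?_, A.isManifold, A.faithfulSMul, fun x => ?_⟩
  · exact ChartedSpace.secondCountable_of_sigmaCompact (EuclideanSpace ℝ (Fin (2 * n + r))) _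
  · set v := A.vertexAt x
    refine ⟨torusEquiv _ _ (A.coframe_mul_frame v) (A.frame_mul_coframe v), A.chartSource v,
      A.chart v, A.chartInv v, A.isOpen_chartSource v, A.mem_chartSource_vertexAt x,
      fun t y hy => A.smul_mem_chartSource t hy, ⟨_, A.isOpen_chartRegion v, A.image_chart⟩,
      fun y hy => A.chartInv_chart hy, A.contMDiffOn_chart v, ?_, fun t y hy => A.chart_smul t hy⟩
    rw [A.image_chart]
    exact A.contMDiffOn_chartInv v

end CharAtlas

/-! ### Lattices and products with tori -/

section Lattice

variable {n r A B N : ℕ}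

/-- Extension of integer vectors by zero along a splitting of the index set. -/
def padMap (e : Fin A ⊕ Fin B ≃ Fin N) : (Fin A → ℤ) →ₗ[ℤ] (Fin N → ℤ) where
  toFun a j := Sum.elim a 0 (e.symm j)
  map_add' a b := by
    funext j
    obtain ⟨j | j, rfl⟩ := e.surjective j <;> simp
  map_smul' c a := by
    funext j
    obtain ⟨j | j, rfl⟩ := e.surjective j <;> simp

@[simp] theorem padMap_inl (e : Fin A ⊕ Fin B ≃ Fin N) (a : Fin A → ℤ) (i : Fin A) :
    padMap e a (e (Sum.inl i)) = a i := by simp [padMap]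

@[simp] theorem padMap_inr (e : Fin A ⊕ Fin B ≃ Fin N) (a : Fin A → ℤ) (j : Fin B) :
    padMap e a (e (Sum.inr j)) = 0 := by simp [padMap]

theorem padMap_injective (e : Fin A ⊕ Fin B ≃ Fin N) : Function.Injective (padMap e) := by
  intro a b h
  funext i
  rw [← padMap_inl e a, h, padMap_inl]

theorem rk_linearMap {E : Type*} [NormedAddCommGroup E] [NormedSpace ℝ E] {P : Set E}
    (η : Facet P → Fin A → ℤ) (L : (Fin A → ℤ) →ₗ[ℤ] (Fin N → ℤ)) (hL : Function.Injective L) :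
    rk (fun F => L (η F)) = rk η := by
  unfold rk
  have : Set.range (fun F => L (η F)) = L '' Set.range η := by rw [← Set.range_comp]; rfl
  rw [this, ← Submodule.map_span]
  exact (LinearEquiv.finrank_eq (Submodule.equivMapOfInjective L hL _)).symm

/-- The map `φ` splits the lattice as the span of the `w i` plus `ker φ`; the kernel is free, being
a submodule of a free `ℤ`-module, and its rank is `r` by counting. -/
theorem exists_basis_castAdd (w : Fin n → Fin (n + r) → ℤ)
    (φ : (Fin (n + r) → ℤ) →ₗ[ℤ] (Fin n → ℤ)) (hφ : ∀ i, φ (w i) = Pi.single i 1) :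
    ∃ b : Module.Basis (Fin (n + r)) ℤ (Fin (n + r) → ℤ), ∀ i, b (Fin.castAdd r i) = w i := by
  set s : (Fin n → ℤ) →ₗ[ℤ] (Fin (n + r) → ℤ) := (Pi.basisFun ℤ (Fin n)).constr ℤ w
  have hs : ∀ i, s (Pi.single i 1) = w i := fun i => by
    rw [← Pi.basisFun_apply]; exact (Pi.basisFun ℤ (Fin n)).constr_basis ℤ w i
  have hφs : ∀ x, φ (s x) = x := by
    have : φ ∘ₗ s = LinearMap.id := (Pi.basisFun ℤ (Fin n)).ext fun i => by
      rw [Pi.basisFun_apply, LinearMap.comp_apply, hs, hφ, LinearMap.id_apply]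
    exact fun x => LinearMap.congr_fun this x
  let T : ((Fin n → ℤ) × LinearMap.ker φ) ≃ₗ[ℤ] (Fin (n + r) → ℤ) :=
    { LinearMap.coprod s (LinearMap.ker φ).subtype with
      invFun := fun y => (φ y, ⟨y - s (φ y), by simp [hφs]⟩)
      left_inv := by
        rintro ⟨x, y, hy⟩
        have hy' : φ y = 0 := hy
        simp [hφs, hy']
      right_inv := fun y => by simp }
  have hT : ∀ x y, T (x, y) = s x + y := fun _ _ => rfl
  have hrank : Module.finrank ℤ (LinearMap.ker φ) = r := by
    have h := T.finrank_eq
    rw [Module.finrank_prod, Module.finrank_fin_fun, Module.finrank_fin_fun] at h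
    omega
  let bK := Module.finBasisOfFinrankEq ℤ (LinearMap.ker φ) hrank
  refine ⟨(((Pi.basisFun ℤ (Fin n)).prod bK).map T).reindex finSumFinEquiv, fun i => ?_⟩
  rw [Module.Basis.reindex_apply, finSumFinEquiv_symm_apply_castAdd, Module.Basis.map_apply]
  have : (Pi.basisFun ℤ (Fin n)).prod bK (Sum.inl i) = (Pi.single i 1, 0) := by
    ext1 <;> simp
  rw [this, hT, hs]
  simp

/-- The ambient basis from Smith normal form, permuted so that the directions met by `S` come first.
-/
theorem exists_basis_of_finrank_span (e : Fin A ⊕ Fin B ≃ Fin N)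
    (S : Submodule ℤ (Fin N → ℤ)) (hS : Module.finrank ℤ S = A) :
    ∃ b : Module.Basis (Fin N) ℤ (Fin N → ℤ), ∀ x ∈ S, ∀ j, b.equivFun x (e (Sum.inr j)) = 0 := by
  obtain ⟨m, snf⟩ := S.smithNormalForm (Pi.basisFun ℤ (Fin N))
  have hm : m = A := by
    rw [← hS, Module.finrank_eq_card_basis snf.bN, Fintype.card_fin]
  subst hm
  obtain ⟨π, hπ⟩ := exists_perm_apply_eq (Function.Embedding.inl.trans e.toEmbedding) snf.f
  refine ⟨snf.bM.reindex π.symm, fun x hx j => ?_⟩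
  rw [Module.Basis.equivFun_apply, Module.Basis.repr_reindex_apply, Equiv.symm_symm]
  refine snf.repr_eq_zero_of_notMem_range ⟨x, hx⟩ ?_
  rintro ⟨i, hi⟩
  rw [← hπ] at hi
  have := e.injective (π.injective hi)
  simp at this

end Lattice

/-! ### Splitting off a torus factor. -/

section Split

variable {A B N : ℕ}

/-- The homomorphism of tori given by a map of index sets. -/
def torusComp (f : Fin A → Fin N) : Torus N →* Torus A where
  toFun t i := t (f i)
  map_one' := rfl
  map_mul' _ _ := rfl

theorem torusComp_apply (f : Fin A → Fin N) (t : Torus N) (i : Fin A) :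
    torusComp f t i = t (f i) := rfl

theorem continuous_torusComp (f : Fin A → Fin N) : Continuous (torusComp f) :=
  continuous_pi fun i => continuous_apply (f i)

/-- Extension of torus elements by `1` along a splitting of the index set. -/
def torusPad (e : Fin A ⊕ Fin B ≃ Fin N) : Torus A →* Torus N where
  toFun a j := Sum.elim a 1 (e.symm j)
  map_one' := by
    funext j
    obtain ⟨j | j, rfl⟩ := e.surjective j <;> simp
  map_mul' a b := by
    funext j
    obtain ⟨j | j, rfl⟩ := e.surjective j <;> simp

theorem torusPad_oneParam (e : Fin A ⊕ Fin B ≃ Fin N) (a : Fin A → ℤ) (s : Circle) :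
    torusPad e (oneParam a s) = oneParam (padMap e a) s := by
  funext j
  obtain ⟨j | j, rfl⟩ := e.surjective j <;> simp [torusPad, oneParam_apply]

variable {E : Type*} [NormedAddCommGroup E] [NormedSpace ℝ E] {P : Set E}
  {ξ : Facet P → Fin N → ℤ} {η : Facet P → Fin A → ℤ} {C D : Matrix (Fin N) (Fin N) ℤ}
  {e : Fin A ⊕ Fin B ≃ Fin N}

theorem mem_isotropy_iff_split (hDC : D * C = 1) (h : ∀ F, C.mulVec (ξ F) = padMap e (η F))
    (p : E) (t : Torus N) : t ∈ isotropy ξ p ↔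
      torusComp (e ∘ Sum.inl) (torusMap C t) ∈ isotropy η p ∧
        torusComp (e ∘ Sum.inr) (torusMap C t) = 1 := by
  constructor
  · intro ht
    have hle : isotropy ξ p ≤ ((isotropy η p).comap (torusComp (e ∘ Sum.inl)) ⊓
        (torusComp (e ∘ Sum.inr)).ker).comap (torusMap C) := by
      rw [isotropy_le_iff]
      intro F hF s
      rw [Subgroup.mem_comap, torusMap_oneParam, h, ← torusPad_oneParam]
      refine Subgroup.mem_inf.2 ⟨?_, ?_⟩
      · have : torusComp (e ∘ Sum.inl) (torusPad e (oneParam (η F) s)) = oneParam (η F) s := by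
          funext i; simp [torusComp_apply, torusPad]
        rw [Subgroup.mem_comap, this]
        exact oneParam_mem_isotropy hF s
      · rw [MonoidHom.mem_ker]
        funext i; simp [torusComp_apply, torusPad]
    exact hle ht
  · rintro ⟨h1, h2⟩
    have hle : isotropy η p ≤ (isotropy ξ p).comap ((torusMap D).comp (torusPad e)) := by
      rw [isotropy_le_iff]
      intro F hF s
      rw [Subgroup.mem_comap, MonoidHom.comp_apply, torusPad_oneParam, torusMap_oneParam, ← h,
        Matrix.mulVec_mulVec, hDC, Matrix.one_mulVec]
      exact oneParam_mem_isotropy hF s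
    have h3 := hle h1
    have h4 : torusPad e (torusComp (e ∘ Sum.inl) (torusMap C t)) = torusMap C t := by
      funext j
      obtain ⟨j | j, rfl⟩ := e.surjective j
      · simp [torusComp_apply, torusPad]
      · have := congrFun h2 j
        rw [torusComp_apply] at this
        simpa [torusPad] using this.symm
    rwa [Subgroup.mem_comap, MonoidHom.comp_apply, h4, ← torusMap_mul, hDC, torusMap_one] at h3

/-- After the change of coordinates `C` the isotropy lies in the first factor, so the quotient only
affects that factor. The induced continuous bijection goes from a compact space to a Hausdorff one.
-/
theorem nonempty_homeomorph_prod_torus [CompactSpace P] [T2Space (CharSpace η)]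
    (hCD : C * D = 1) (hDC : D * C = 1) (h : ∀ F, C.mulVec (ξ F) = padMap e (η F)) :
    Nonempty (CharSpace ξ ≃ₜ CharSpace η × Torus B) := by
  let f₀ : Torus N × P → CharSpace η × Torus B := fun u =>
    (CharSpace.mk η (torusComp (e ∘ Sum.inl) (torusMap C u.1), u.2),
      torusComp (e ∘ Sum.inr) (torusMap C u.1))
  have hf₀ : Continuous f₀ := by
    have h1 : Continuous fun u : Torus N × P => torusMap C u.1 :=
      (continuous_torusMap C).comp continuous_fst
    exact (CharSpace.continuous_mk.comp
      (((continuous_torusComp _).comp h1).prodMk continuous_snd)).prodMk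
        ((continuous_torusComp _).comp h1)
  have hkey : ∀ u w : Torus N × P, f₀ u = f₀ w ↔ CharSpace.mk ξ u = CharSpace.mk ξ w := by
    rintro ⟨t, p⟩ ⟨s, q⟩
    rw [Prod.ext_iff, CharSpace.mk_eq_mk_iff, CharSpace.mk_eq_mk_iff,
      mem_isotropy_iff_split hDC h, map_mul, map_mul, map_mul, map_inv, map_inv, map_inv,
      inv_mul_eq_one, and_assoc]
  let f : CharSpace ξ → CharSpace η × Torus B :=
    Quotient.lift f₀ fun u w huw => (hkey u w).2 (Quotient.sound huw)
  have hfm : ∀ u, f (CharSpace.mk ξ u) = f₀ u := fun _ => rfl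
  have hf : Continuous f := CharSpace.isQuotientMap_mk.continuous_iff.2 hf₀
  have hbij : Function.Bijective f := by
    constructor
    · intro x y hxy
      obtain ⟨u, rfl⟩ := CharSpace.mk_surjective x
      obtain ⟨w, rfl⟩ := CharSpace.mk_surjective y
      exact (hkey u w).1 hxy
    · rintro ⟨x, w⟩
      obtain ⟨⟨s, p⟩, rfl⟩ := CharSpace.mk_surjective x
      refine ⟨CharSpace.mk ξ (torusMap D fun j => Sum.elim s w (e.symm j), p), ?_⟩
      rw [hfm]
      have h1 : torusMap C (torusMap D fun j => Sum.elim s w (e.symm j)) =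
          fun j => Sum.elim s w (e.symm j) := by
        rw [← torusMap_mul, hCD, torusMap_one]
      have h2 : torusComp (e ∘ Sum.inl) (fun j => Sum.elim s w (e.symm j)) = s := by
        funext i; simp [torusComp_apply]
      have h3 : torusComp (e ∘ Sum.inr) (fun j => Sum.elim s w (e.symm j)) = w := by
        funext i; simp [torusComp_apply]
      simp only [f₀, h1, h2, h3]
  exact ⟨Continuous.homeoOfEquivCompactToT2 (f := Equiv.ofBijective f hbij) hf⟩

end Split

/-! ### Topological invariance of the rank -/

/-- In Smith normal form the annihilator consists of the functionals killing the adapted basis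
vectors, since the invariant factors are nonzero and `ℤ` has no zero divisors. -/
theorem finrank_dualAnnihilator_add {N : ℕ} (S : Submodule ℤ (Fin N → ℤ)) :
    Module.finrank ℤ S.dualAnnihilator + Module.finrank ℤ S = N := by
  obtain ⟨m, snf⟩ := S.smithNormalForm (Pi.basisFun ℤ (Fin N))
  have hm : Module.finrank ℤ S = m := by
    rw [Module.finrank_eq_card_basis snf.bN, Fintype.card_fin]
  let ψ : Module.Dual ℤ (Fin N → ℤ) →ₗ[ℤ] (Fin m → ℤ) :=
    LinearMap.pi fun i => Module.Dual.eval ℤ _ (snf.bM (snf.f i))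
  have hψ : ∀ c i, ψ c i = c (snf.bM (snf.f i)) := fun _ _ => rfl
  have hsurj : LinearMap.range ψ = ⊤ := by
    refine LinearMap.range_eq_top.2 fun x => ⟨snf.bM.constr ℤ (Function.extend snf.f x 0), ?_⟩
    funext i
    rw [hψ, Module.Basis.constr_basis, snf.f.injective.extend_apply]
  have ha : ∀ i, snf.a i ≠ 0 := by
    intro i h0
    refine snf.bN.ne_zero i (Subtype.ext ?_)
    rw [snf.snf, h0, zero_smul]; rfl
  have hker : LinearMap.ker ψ = S.dualAnnihilator := by
    ext c
    rw [LinearMap.mem_ker, Submodule.mem_dualAnnihilator]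
    constructor
    · intro h x hx
      have h0 : c ∘ₗ S.subtype = 0 := snf.bN.ext fun i => by
        have := congrFun h i
        rw [hψ] at this
        simp only [LinearMap.comp_apply, Submodule.subtype_apply, snf.snf, map_smul, this,
          LinearMap.zero_apply]
        simp
      exact LinearMap.congr_fun h0 ⟨x, hx⟩
    · intro h
      funext i
      have h1 := h _ (snf.bN i).2
      rw [snf.snf, map_smul, smul_eq_mul] at h1
      rw [hψ]
      exact (mul_eq_zero.1 h1).resolve_left (ha i)
  have h := (LinearMap.ker ψ).finrank_quotient_add_finrank
  rw [(ψ.quotKerEquivOfSurjective (LinearMap.range_eq_top.1 hsurj)).finrank_eq,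
    Module.finrank_fin_fun, hker, ← (Pi.basisFun ℤ (Fin N)).toDualEquiv.finrank_eq, Module.finrank_fin_fun] at h
  omega

/-! ### Degrees of circle-valued maps on `M(P, ξ)`. -/

section Degree

variable {E : Type*} [NormedAddCommGroup E] [NormedSpace ℝ E] {P : Set E} {N : ℕ}

/-- The exponential map `ℝ^N → T^N`. -/
def torusExp (y : Fin N → ℝ) : Torus N := fun j => Circle.exp (y j)

theorem torusExp_add (y z : Fin N → ℝ) : torusExp (y + z) = torusExp y * torusExp z := by
  funext j; exact Circle.exp_add _ _

theorem continuous_torusExp : Continuous (torusExp (N := N)) :=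
  continuous_pi fun j => Circle.exp.continuous.comp (continuous_apply j)

theorem torusExp_surjective : Function.Surjective (torusExp (N := N)) := by
  intro t
  choose y hy using fun j => Circle.exp_surjective (t j)
  exact ⟨y, funext hy⟩

theorem isOpenMap_torusExp : IsOpenMap (torusExp (N := N)) :=
  IsOpenMap.piMap (fun _ => Circle.isCoveringMap_exp.isLocalHomeomorph.isOpenMap)
    (Filter.Eventually.of_forall fun _ => Circle.exp_surjective)

/-- The point of the lattice `2πℤ^N` given by an integer vector. -/
def period (m : Fin N → ℤ) : Fin N → ℝ := fun j => 2 * Real.pi * m j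

theorem period_add (m m' : Fin N → ℤ) : period (m + m') = period m + period m' := by
  funext j; simp [period, mul_add]

theorem torusExp_period (m : Fin N → ℤ) : torusExp (period m) = 1 := by
  funext j; exact Circle.exp_two_pi_mul_int _

theorem torusExp_eq_iff {y z : Fin N → ℝ} :
    torusExp y = torusExp z ↔ ∃ m, y = z + period m := by
  constructor
  · intro h
    choose m hm using fun j => Circle.exp_eq_exp.1 (congrFun h j)
    refine ⟨m, funext fun j => ?_⟩
    rw [hm j, Pi.add_apply, period]; ring
  · rintro ⟨m, rfl⟩
    rw [torusExp_add, torusExp_period, mul_one]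

theorem torusExp_smul_intCast (a : Fin N → ℤ) (θ : ℝ) :
    torusExp (fun j => θ * (a j : ℝ)) = oneParam a (Circle.exp θ) := by
  funext j
  rw [oneParam_apply, torusExp, ← Circle.exp_zsmul, zsmul_eq_mul, mul_comm]

/-- The covering `ℝ^N × P → T^N × P` followed by the projection to `M(P, ξ)`. -/
def expCover (ξ : Facet P → Fin N → ℤ) (a : (Fin N → ℝ) × P) : CharSpace ξ :=
  CharSpace.mk ξ (torusExp a.1, a.2)

theorem isQuotientMap_expCover (ξ : Facet P → Fin N → ℤ) :
    Topology.IsQuotientMap (expCover ξ) := by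
  have h : Topology.IsQuotientMap (Prod.map (torusExp (N := N)) (id : P → P)) :=
    (isOpenMap_torusExp.prodMap IsOpenMap.id).isQuotientMap
      (continuous_torusExp.prodMap continuous_id)
      (torusExp_surjective.prodMap Function.surjective_id)
  exact CharSpace.isQuotientMap_mk.comp h

theorem expCover_add_period (ξ : Facet P → Fin N → ℤ) (y : Fin N → ℝ) (m : Fin N → ℤ) (p : P) :
    expCover ξ (y + period m, p) = expCover ξ (y, p) := by
  rw [expCover, torusExp_add, torusExp_period, mul_one]; rfl

/-- The space `ℝ^N × P` contracts linearly to `(0, p₀)`; lifting this homotopy through `ℝ → S¹` and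
evaluating at time `1` gives the logarithm. -/
theorem exists_lift_circle (hP : Convex ℝ P) (hne : P.Nonempty)
    (f : C((Fin N → ℝ) × P, Circle)) :
    ∃ G : C((Fin N → ℝ) × P, ℝ), ∀ a, Circle.exp (G a) = f a := by
  obtain ⟨p₀, hp₀⟩ := hne
  let contr : C(unitInterval × ((Fin N → ℝ) × P), (Fin N → ℝ) × P) :=
    ⟨fun x => ((x.1 : ℝ) • x.2.1, ⟨(1 - (x.1 : ℝ)) • p₀ + (x.1 : ℝ) • (x.2.2 : E),
      hP hp₀ x.2.2.2 (by linarith [x.1.2.2]) x.1.2.1 (by ring)⟩), by fun_prop⟩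
  obtain ⟨θ, hθ⟩ := Circle.exp_surjective (f (0, ⟨p₀, hp₀⟩))
  have h0 : ∀ a, (f.comp contr) (0, a) = Circle.exp (ContinuousMap.const _ θ a) := by
    intro a
    rw [ContinuousMap.const_apply, hθ, ContinuousMap.comp_apply]
    congr 1
    simp [contr]
  let H := Circle.isCoveringMap_exp.liftHomotopy (f.comp contr) (ContinuousMap.const _ θ) h0
  refine ⟨H.comp ((ContinuousMap.const _ 1).prodMk (ContinuousMap.id _)), fun a => ?_⟩
  have h1 := congrFun (Circle.isCoveringMap_exp.liftHomotopy_lifts (f.comp contr) _ h0) (1, a)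
  refine Eq.trans h1 ?_
  rw [ContinuousMap.comp_apply]
  congr 1
  simp [contr]

/-- The functional `c` records the behaviour of `G` under translations by periods. -/
def IsDegree {X : Type*} (G : (Fin N → ℝ) × X → ℝ) (c : Module.Dual ℤ (Fin N → ℤ)) : Prop :=
  ∀ y p m, G (y + period m, p) = G (y, p) + 2 * Real.pi * c m

theorem IsDegree.add {X : Type*} {G G' : (Fin N → ℝ) × X → ℝ} {c c' : Module.Dual ℤ (Fin N → ℤ)}
    (h : IsDegree G c) (h' : IsDegree G' c') : IsDegree (fun a => G a + G' a) (c + c') := by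
  intro y p m
  simp only [h y p m, h' y p m, LinearMap.add_apply]
  push_cast
  ring

theorem eq_of_circleExp_eq_const {X : Type*} [TopologicalSpace X] [PreconnectedSpace X] {g : X → ℝ}
    (hg : Continuous g) {z : Circle} (h : ∀ x, Circle.exp (g x) = z) (x y : X) : g x = g y :=
  Circle.isCoveringMap_exp.const_of_comp hg (fun a b => (h a).trans (h b).symm) x y

/-- Two lifts of one circle-valued map differ by a constant, so they have the same periods. -/
theorem IsDegree.unique (hP : Convex ℝ P) (hne : P.Nonempty) {G G' : (Fin N → ℝ) × P → ℝ}
    (hG : Continuous G) (hG' : Continuous G') {c c' : Module.Dual ℤ (Fin N → ℤ)}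
    (h : IsDegree G c) (h' : IsDegree G' c') (he : ∀ a, Circle.exp (G a) = Circle.exp (G' a)) :
    c = c' := by
  have : PreconnectedSpace P := Subtype.preconnectedSpace hP.isPreconnected
  obtain ⟨p, hp⟩ := hne
  refine LinearMap.ext fun m => ?_
  have h1 := eq_of_circleExp_eq_const (g := fun a => G a - G' a) (hG.sub hG') (z := 1)
    (fun a => by rw [Circle.exp_sub, he, div_self']) (0 + period m, ⟨p, hp⟩) (0, ⟨p, hp⟩)
  simp only [h 0 ⟨p, hp⟩ m, h' 0 ⟨p, hp⟩ m] at h1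
  have h2 : 2 * Real.pi * ((c m : ℝ) - c' m) = 0 := by linarith
  have h3 := (mul_eq_zero.1 h2).resolve_left Real.two_pi_pos.ne'
  exact_mod_cast sub_eq_zero.1 h3

variable {ξ : Facet P → Fin N → ℤ}

/-- Over a facet the circle of `ξ F` is collapsed, so the circle-valued map is constant along this
line, and by connectedness so is its lift. -/
theorem lift_add_smul (f : CharSpace ξ → Circle) {G : (Fin N → ℝ) × P → ℝ} (hG : Continuous G)
    (hf : ∀ a, Circle.exp (G a) = f (expCover ξ a)) {F : Facet P} {p : P} (hp : (p : E) ∈ F.1)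
    (y : Fin N → ℝ) (θ : ℝ) : G (y + (fun j => θ * (ξ F j : ℝ)), p) = G (y, p) := by
  have h1 := eq_of_circleExp_eq_const (g := fun θ : ℝ => G (y + (fun j => θ * (ξ F j : ℝ)), p))
    (hG.comp (by fun_prop)) (z := f (expCover ξ (y, p))) (fun θ => by
      rw [hf]
      congr 1
      refine CharSpace.mk_eq_mk_iff.2 ⟨rfl, ?_⟩
      dsimp only
      rw [torusExp_add, torusExp_smul_intCast, mul_inv, mul_comm (torusExp y)⁻¹,
        inv_mul_cancel_right, ← map_inv]
      exact oneParam_mem_isotropy hp _) θ 0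
  have h2 : y + (fun j => (0 : ℝ) * (ξ F j : ℝ)) = y := by funext j; simp
  rw [h2] at h1
  exact h1

/-- Changes of the lift under periods are integral and independent of the point, hence additive.
They vanish on `ξ F` because following that direction for time `2π` over a point of `F` leaves the
lift unchanged. -/
theorem exists_isDegree (hP : Convex ℝ P) (hne : P.Nonempty) (f : CharSpace ξ → Circle)
    {G : (Fin N → ℝ) × P → ℝ} (hG : Continuous G)
    (hf : ∀ a, Circle.exp (G a) = f (expCover ξ a)) :
    ∃ c ∈ (Submodule.span ℤ (Set.range ξ)).dualAnnihilator, IsDegree G c := by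
  have : PreconnectedSpace P := Subtype.preconnectedSpace hP.isPreconnected
  obtain ⟨p₀, hp₀⟩ := hne
  set q : P := ⟨p₀, hp₀⟩
  have hone : ∀ m a, Circle.exp (G (a.1 + period m, a.2) - G a) = 1 := fun m a => by
    rw [Circle.exp_sub, hf, hf, expCover_add_period, div_self']
  choose c hc using fun m => Circle.exp_eq_one.1 (hone m (0, q))
  have hdeg : ∀ y p m, G (y + period m, p) = G (y, p) + 2 * Real.pi * c m := by
    intro y p m
    have h1 := eq_of_circleExp_eq_const (g := fun a => G (a.1 + period m, a.2) - G a)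
      ((hG.comp (by fun_prop)).sub hG) (hone m) (y, p) (0, q)
    dsimp only at h1
    rw [hc m] at h1
    linarith
  have hadd : ∀ m m', c (m + m') = c m + c m' := by
    intro m m'
    have h1 := hdeg 0 q (m + m')
    rw [period_add, ← add_assoc, hdeg, hdeg] at h1
    have h2 : 2 * Real.pi * ((c (m + m') : ℝ) - (c m + c m')) = 0 := by linarith
    have h3 := (mul_eq_zero.1 h2).resolve_left Real.two_pi_pos.ne'
    exact_mod_cast sub_eq_zero.1 h3
  refine ⟨(AddMonoidHom.mk' c hadd).toIntLinearMap, ?_, hdeg⟩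
  rw [Submodule.mem_dualAnnihilator]
  suffices Submodule.span ℤ (Set.range ξ) ≤
      LinearMap.ker (AddMonoidHom.mk' c hadd).toIntLinearMap from fun x hx => this hx
  rw [Submodule.span_le]
  rintro _ ⟨F, rfl⟩
  obtain ⟨p, hp⟩ := F.2.nonempty
  have hpP : p ∈ P := F.2.isExposed.subset hp
  have h1 := lift_add_smul f hG hf (p := ⟨p, hpP⟩) hp 0 (2 * Real.pi)
  have h2 := hdeg 0 ⟨p, hpP⟩ (ξ F)
  rw [show period (ξ F) = fun j => 2 * Real.pi * (ξ F j : ℝ) from rfl, h1] at h2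
  have h3 : 2 * Real.pi * (c (ξ F) : ℝ) = 0 := by linarith
  have h4 := (mul_eq_zero.1 h3).resolve_left Real.two_pi_pos.ne'
  show c (ξ F) = 0
  exact_mod_cast h4

theorem lift_eq_of_expCover_eq (f : CharSpace ξ → Circle) {G : (Fin N → ℝ) × P → ℝ}
    (hG : Continuous G) (hf : ∀ a, Circle.exp (G a) = f (expCover ξ a)) (hdeg : IsDegree G 0)
    {a b : (Fin N → ℝ) × P} (hab : expCover ξ a = expCover ξ b) : G a = G b := by
  have hper : ∀ {y z : Fin N → ℝ} {p : P}, torusExp y = torusExp z → G (y, p) = G (z, p) := by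
    intro y z p h
    obtain ⟨m, rfl⟩ := torusExp_eq_iff.1 h
    simpa using hdeg z p m
  obtain ⟨y, p⟩ := a
  obtain ⟨z, q⟩ := b
  obtain ⟨hpq, hiso⟩ := CharSpace.mk_eq_mk_iff.1 hab
  dsimp only at hpq hiso
  subst hpq
  -- The elements of the torus over which the lift is invariant above `p` form a subgroup, so it
  -- suffices to check the generating circles of the isotropy group.
  let H : Subgroup (Torus N) :=
    { carrier := {t | ∀ y z, torusExp z = torusExp y * t → G (y, p) = G (z, p)}
      one_mem' := fun y z h => hper (by rw [h, mul_one])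
      mul_mem' := by
        intro s t hs ht y z h
        obtain ⟨w, hw⟩ := torusExp_surjective (torusExp y * s)
        exact (hs y w hw).trans (ht w z (by rw [h, hw, mul_assoc]))
      inv_mem' := by
        intro t ht y z h
        exact (ht z y (by rw [h, inv_mul_cancel_right])).symm }
  have hle : isotropy ξ (p : E) ≤ H := by
    rw [isotropy_le_iff]
    intro F hF s y z h
    obtain ⟨θ, rfl⟩ := Circle.exp_surjective s
    rw [← torusExp_smul_intCast, ← torusExp_add] at h
    rw [hper h, lift_add_smul f hG hf hF]
  exact hle hiso y z (by rw [mul_inv_cancel_left])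

theorem exists_descent (f : CharSpace ξ → Circle) {G : (Fin N → ℝ) × P → ℝ} (hG : Continuous G)
    (hf : ∀ a, Circle.exp (G a) = f (expCover ξ a)) (hdeg : IsDegree G 0) :
    ∃ g : CharSpace ξ → ℝ, Continuous g ∧ ∀ x, Circle.exp (g x) = f x := by
  have hq := isQuotientMap_expCover ξ
  choose s hs using hq.surjective
  have hval : ∀ a, G (s (expCover ξ a)) = G a := fun a =>
    lift_eq_of_expCover_eq f hG hf hdeg (hs _)
  refine ⟨fun x => G (s x), hq.continuous_iff.2 ?_, fun x => by rw [hf, hs]⟩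
  exact hG.congr fun a => (hval a).symm

/-- The linear form on `ℝ^N` extending a functional on `ℤ^N`. -/
def realForm (c : Module.Dual ℤ (Fin N → ℤ)) (y : Fin N → ℝ) : ℝ := ∑ j, (c (Pi.single j 1) : ℝ) * y j

theorem dual_apply_eq_sum (c : Module.Dual ℤ (Fin N → ℤ)) (m : Fin N → ℤ) :
    c m = ∑ j, c (Pi.single j 1) * m j := by
  conv_lhs => rw [pi_eq_sum_univ' m]
  rw [map_sum]
  refine Finset.sum_congr rfl fun j _ => ?_
  rw [map_smul, smul_eq_mul, mul_comm]

theorem isDegree_realForm {X : Type*} (c : Module.Dual ℤ (Fin N → ℤ)) :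
    IsDegree (fun a : (Fin N → ℝ) × X => realForm c a.1) c := by
  intro y p m
  rw [dual_apply_eq_sum c m]
  push_cast
  simp only [realForm, Pi.add_apply, mul_add, Finset.sum_add_distrib, Finset.mul_sum, period]
  congr 1
  exact Finset.sum_congr rfl fun j _ => by ring

theorem continuous_realForm {X : Type*} [TopologicalSpace X] (c : Module.Dual ℤ (Fin N → ℤ)) :
    Continuous fun a : (Fin N → ℝ) × X => realForm c a.1 := by
  unfold realForm
  fun_prop

theorem realForm_add (c c' : Module.Dual ℤ (Fin N → ℤ)) (y : Fin N → ℝ) :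
    realForm (c + c') y = realForm c y + realForm c' y := by
  simp only [realForm, LinearMap.add_apply, Int.cast_add, add_mul, Finset.sum_add_distrib]

/-- The character of the torus given by a functional on `ℤ^N`. -/
def torusChar (c : Module.Dual ℤ (Fin N → ℤ)) : Torus N →* Circle where
  toFun t := ∏ j, t j ^ c (Pi.single j 1)
  map_one' := by simp
  map_mul' s t := by simp [mul_zpow, Finset.prod_mul_distrib]

theorem torusChar_apply (c : Module.Dual ℤ (Fin N → ℤ)) (t : Torus N) :
    torusChar c t = ∏ j, t j ^ c (Pi.single j 1) := rfl

theorem torusChar_torusExp (c : Module.Dual ℤ (Fin N → ℤ)) (y : Fin N → ℝ) :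
    torusChar c (torusExp y) = Circle.exp (realForm c y) := by
  rw [torusChar_apply, realForm]
  have : Circle.exp (∑ j, (c (Pi.single j 1) : ℝ) * y j) =
      ∏ j, Circle.exp ((c (Pi.single j 1) : ℝ) * y j) := by
    classical
    induction (Finset.univ : Finset (Fin N)) using Finset.induction_on with
    | empty => simp
    | insert i s hi ih => rw [Finset.sum_insert hi, Finset.prod_insert hi, Circle.exp_add, ih]
  rw [this]
  refine Finset.prod_congr rfl fun j _ => ?_
  rw [torusExp, ← Circle.exp_zsmul, zsmul_eq_mul]

theorem torusChar_oneParam (c : Module.Dual ℤ (Fin N → ℤ)) (a : Fin N → ℤ) (s : Circle) :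
    torusChar c (oneParam a s) = s ^ c a := by
  rw [torusChar_apply, dual_apply_eq_sum c a, prod_zpow_sum]
  exact Finset.prod_congr rfl fun j _ => by rw [oneParam_apply, ← zpow_mul, mul_comm]

theorem isotropy_le_ker_torusChar {c : Module.Dual ℤ (Fin N → ℤ)}
    (hc : c ∈ (Submodule.span ℤ (Set.range ξ)).dualAnnihilator) (x : E) :
    isotropy ξ x ≤ (torusChar c).ker := by
  rw [isotropy_le_iff]
  intro F _ s
  rw [MonoidHom.mem_ker, torusChar_oneParam,
    (Submodule.mem_dualAnnihilator c).1 hc _ (Submodule.subset_span ⟨F, rfl⟩), zpow_zero]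

/-- The circle-valued function on `M(P, ξ)` given by a character vanishing on the isotropy. -/
def charMap (c : (Submodule.span ℤ (Set.range ξ)).dualAnnihilator) (x : CharSpace ξ) : Circle :=
  Quotient.lift (fun u : Torus N × P => torusChar c.1 u.1) (fun u v (h : (charSetoid ξ).r u v) => by
    have := isotropy_le_ker_torusChar c.2 _ h.2
    rw [MonoidHom.mem_ker, map_mul, map_inv, inv_mul_eq_one] at this
    exact this) x

theorem charMap_expCover (c : (Submodule.span ℤ (Set.range ξ)).dualAnnihilator)
    (a : (Fin N → ℝ) × P) : charMap c (expCover ξ a) = Circle.exp (realForm c.1 a.1) :=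
  torusChar_torusExp c.1 a.1

theorem continuous_charMap (c : (Submodule.span ℤ (Set.range ξ)).dualAnnihilator) :
    Continuous (charMap c) := by
  refine (isQuotientMap_expCover ξ).continuous_iff.2 ?_
  exact (Circle.exp.continuous.comp (continuous_realForm c.1)).congr fun a =>
    (charMap_expCover c a).symm

theorem charMap_add (c c' : (Submodule.span ℤ (Set.range ξ)).dualAnnihilator) (x : CharSpace ξ) :
    charMap (c + c') x = charMap c x * charMap c' x := by
  obtain ⟨a, rfl⟩ := (isQuotientMap_expCover ξ).surjective x
  rw [charMap_expCover, charMap_expCover, charMap_expCover, ← Circle.exp_add, ← realForm_add]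
  rfl

/-- Pulling characters back along `h` and taking degrees is a linear map from the annihilator for
`η` to that for `ξ`. If a degree vanishes, the pulled-back map has a real logarithm, hence so does
the original one; its degree `c` is then zero. Injectivity compares the ranks of the annihilators.
-/
theorem rk_le_of_homeomorph (hP : Convex ℝ P) (hne : P.Nonempty) {η : Facet P → Fin N → ℤ}
    (h : CharSpace ξ ≃ₜ CharSpace η) : rk ξ ≤ rk η := by
  have hlift : ∀ c : (Submodule.span ℤ (Set.range η)).dualAnnihilator,
      ∃ G : (Fin N → ℝ) × P → ℝ, Continuous G ∧
        ∀ a, Circle.exp (G a) = charMap c (h (expCover ξ a)) := fun c => by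
    obtain ⟨G, hG⟩ := exists_lift_circle hP hne ⟨fun a => charMap c (h (expCover ξ a)),
      (continuous_charMap c).comp (h.continuous.comp (isQuotientMap_expCover ξ).continuous)⟩
    exact ⟨G, G.continuous, hG⟩
  choose G hG hGe using hlift
  have hdeg := fun c => exists_isDegree hP hne (fun x => charMap c (h x)) (hG c) (hGe c)
  choose d hd hdG using hdeg
  have hadd : ∀ c c', d (c + c') = d c + d c' := by
    intro c c'
    refine IsDegree.unique hP hne (hG _) ((hG c).add (hG c')) (hdG _) ((hdG c).add (hdG c')) ?_
    intro a
    rw [hGe, charMap_add, ← hGe, ← hGe, ← Circle.exp_add]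
    rfl
  let L : (Submodule.span ℤ (Set.range η)).dualAnnihilator →ₗ[ℤ]
      (Submodule.span ℤ (Set.range ξ)).dualAnnihilator :=
    (AddMonoidHom.mk' (fun c => ⟨d c, hd c⟩) fun c c' => Subtype.ext (hadd c c')).toIntLinearMap
  have hL : Function.Injective L := by
    rw [← LinearMap.ker_eq_bot, LinearMap.ker_eq_bot']
    intro c hc
    have hc0 : d c = 0 := congrArg Subtype.val hc
    have hdeg0 : IsDegree (G c) 0 := hc0 ▸ hdG c
    obtain ⟨g, hg, hge⟩ := exists_descent (fun x => charMap c (h x)) (hG c) (hGe c) hdeg0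
    have h0 : IsDegree (fun a => g (h.symm (expCover η a))) 0 := by
      intro y p m
      simp [expCover_add_period]
    refine Subtype.ext (IsDegree.unique hP hne (continuous_realForm c.1)
      (hg.comp (h.symm.continuous.comp (isQuotientMap_expCover η).continuous))
      (isDegree_realForm c.1) h0 fun a => ?_)
    rw [Function.comp_apply, Function.comp_apply, hge, h.apply_symm_apply, charMap_expCover]
  have h1 := LinearMap.finrank_le_finrank_of_injective hL
  have h2 := finrank_dualAnnihilator_add (Submodule.span ℤ (Set.range η))
  have h3 := finrank_dualAnnihilator_add (Submodule.span ℤ (Set.range ξ))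
  unfold rk
  omega

theorem rk_eq_of_homeomorph (hP : Convex ℝ P) (hne : P.Nonempty) {η : Facet P → Fin N → ℤ}
    (h : CharSpace ξ ≃ₜ CharSpace η) : rk ξ = rk η :=
  (rk_le_of_homeomorph hP hne h).antisymm (rk_le_of_homeomorph hP hne h.symm)

end Degree

/-! ### Reduction of a hyper characteristic function -/

theorem exists_reduction {E : Type*} [NormedAddCommGroup E] [NormedSpace ℝ E] {P : Set E}
    {n k r B : ℕ} (e : Fin (n + r) ⊕ Fin B ≃ Fin (n + k)) {ξ : Facet P → Fin (n + k) → ℤ}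
    (hξ : IsHyperCharacteristic n k ξ) (hrk : rk ξ = n + r) :
    ∃ (η : Facet P → Fin (n + r) → ℤ) (C D : Matrix (Fin (n + k)) (Fin (n + k)) ℤ),
      IsHyperCharacteristic n r η ∧ rk η = n + r ∧ C * D = 1 ∧ D * C = 1 ∧
        ∀ F, C.mulVec (ξ F) = padMap e (η F) := by
  obtain ⟨b, hb⟩ := exists_basis_of_finrank_span e (Submodule.span ℤ (Set.range ξ)) hrk
  obtain ⟨D, C, hDC, hCD, hC⟩ := exists_matrix_of_basis b
  let η : Facet P → Fin (n + r) → ℤ := fun F i => b.equivFun (ξ F) (e (Sum.inl i))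
  have hη : ∀ F, b.equivFun (ξ F) = padMap e (η F) := by
    intro F
    funext j
    obtain ⟨j | j, rfl⟩ := e.surjective j
    · rw [padMap_inl]
    · rw [padMap_inr, hb _ (Submodule.subset_span ⟨F, rfl⟩)]
  let L : (Fin (n + r) → ℤ) →ₗ[ℤ] (Fin (n + k) → ℤ) := b.equivFun.symm.toLinearMap ∘ₗ padMap e
  have hL : ∀ F, L (η F) = ξ F := fun F => by
    show b.equivFun.symm (padMap e (η F)) = ξ F
    rw [← hη, LinearEquiv.symm_apply_apply]
  refine ⟨η, C, D, ?_, ?_, hCD, hDC, fun F => by rw [hC, hη]⟩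
  · intro F hF hne
    obtain ⟨b', e', h'⟩ := hξ F hF hne
    -- Coordinates in a basis extending the `ξ (F i)`, restricted to the smaller lattice, are dual
    -- to the `η (F i)`.
    let φ : (Fin (n + r) → ℤ) →ₗ[ℤ] (Fin n → ℤ) :=
      LinearMap.funLeft ℤ ℤ e' ∘ₗ b'.equivFun.toLinearMap ∘ₗ L
    obtain ⟨c, hc⟩ := exists_basis_castAdd (fun i => η (F i)) φ (fun i => by
      funext j
      show b'.equivFun (L (η (F i))) (e' j) = _
      rw [hL, ← h', Module.Basis.equivFun_self, Pi.single_apply]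
      simp [eq_comm])
    exact ⟨c, ⟨Fin.castAdd r, Fin.castAdd_injective n r⟩, hc⟩
  · have h := rk_linearMap η L (b.equivFun.symm.injective.comp (padMap_injective e))
    simp only [hL] at h
    rw [← h, hrk]

end ToricTopology

end

theorem proposition2p5 {E : Type*} [NormedAddCommGroup E] [NormedSpace ℝ E]
    [FiniteDimensional ℝ E] (n k r : ℕ) (hr : r < k)
    (P : Set E) (hP : ToricTopology.IsSimplePolytope n P)
    (ξ : ToricTopology.Facet P → Fin (n + k) → ℤ)
    (hξ : ToricTopology.IsHyperCharacteristic n k ξ) :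
    ToricTopology.rk ξ = n + r ↔
      ∃ ξ' : ToricTopology.Facet P → Fin (n + r) → ℤ,
        ToricTopology.IsHyperCharacteristic n r ξ' ∧
        ToricTopology.rk ξ' = n + r ∧
        ToricTopology.AdmitsLocallyStandardStructure n r (ToricTopology.CharSpace ξ') ∧
        Nonempty (ToricTopology.CharSpace ξ ≃ₜ
          ToricTopology.CharSpace ξ' × ToricTopology.Torus (k - r)) := by
  have hfin := hP.isPolytope.finite_facet
  have hcpt : CompactSpace P := isCompact_iff_compactSpace.1 hP.isPolytope.isCompact
  obtain ⟨D⟩ := hP.nonempty_facetAtlas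
  let e : Fin (n + r) ⊕ Fin (k - r) ≃ Fin (n + k) :=
    finSumFinEquiv.trans (finCongr (by omega))
  constructor
  · intro hrk
    obtain ⟨η, C, C', hη, hrkη, h1, h2, h⟩ := ToricTopology.exists_reduction e hξ hrk
    obtain ⟨A⟩ := D.nonempty_charAtlas hη
    have := A.t2Space
    exact ⟨η, hη, hrkη, A.admitsLocallyStandardStructure,
      ToricTopology.nonempty_homeomorph_prod_torus h1 h2 h⟩
  · rintro ⟨η, hη, hrkη, -, ⟨f⟩⟩
    obtain ⟨A⟩ := D.nonempty_charAtlas hη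
    have := A.t2Space
    -- The product with the torus is itself the space of `η` padded by zeros, with no change of
    -- basis; both spaces now use the same torus `T^(n+k)` and their ranks can be compared.
    obtain ⟨g⟩ := ToricTopology.nonempty_homeomorph_prod_torus (C := 1) (D := 1)
      (ξ := fun F => ToricTopology.padMap e (η F)) (mul_one 1) (mul_one 1)
      (fun F => Matrix.one_mulVec _)
    rw [ToricTopology.rk_eq_of_homeomorph hP.isPolytope.convex hP.isPolytope.nonempty
      (f.trans g.symm), ToricTopology.rk_linearMap η _ (ToricTopology.padMap_injective e), hrkη]
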